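/- **Theorem 1.1.** Let $\mu>0$, $\lambda\in\mathbb{R}$ with $2\mu+\lambda>0$, $A>0$ and $\gamma>1$, and consider the Cauchy problem for the one-dimensional isentropic compressible Navier–Stokes equations $$\rho_t+(\rho u)_x=0,\qquad (\rho u)_t+(\rho u^2)_x+p_x=(2\mu+\lambda)\,u_{xx},\qquad p=A\rho^\gamma,\qquad x\in\mathbb{R},$$ with continuous initial data $(\rho,u)|_{t=0}=(\rho_0,u_0)$ on $\mathbb{R}$ such that $$\operatorname{supp}\rho_0=[0,1],\qquad \rho_0(x)>0\ \text{ for } x\in(0,1).$$ Suppose that at least one of the following two conditions holds: 1. there are $\lambda_1>0$ and $\lambda_3\in(0,1)$ with $\dfrac{(\rho_0)_x}{\rho_0}\ge\lambda_1$ and $u_0\le 0$ in $(0,\lambda_3)$, and $u_0(\lambda_3)<0$; 2. there are $\lambda_2>0$ and $\lambda_4\in(0,1)$ with $\dfrac{(\rho_0)_x}{\rho_0}\le-\lambda_2$ and $u_0\ge 0$ in $(\lambda_4,1)$, and $u_0(\lambda_4)>0$. Then for every real $m>2$ and every $T>0$ the Cauchy problem has no solution $(\rho,u)$ with $\rho,u\in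 C^1([0,T];H^m(\mathbb{R}))$. (Here the equations are only required to hold in the sense of distributions in $x$ at each time $t\in(0,T)$, so that in particular there is no classical solution in this class.) -/

import Mathlib

open MeasureTheory Set
open scoped SchwartzMap ContDiff

noncomputable section

namespace IsentropicNS

/-- `g` is the Bessel potential of order `s` of the real function `f ∈ L²(ℝ)`, i.e.
`𝓕 g = (1 + |ξ|²)^(s/2) 𝓕 f` with `g ∈ L²(ℝ)`. For `s ≥ 0`, the Sobolev space `H^s(ℝ)` consists of
the (a.e. classes of) functions `f` that have such a `g`, and `‖f‖_{H^s} = ‖g‖_{L²}`. -/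
def HasBesselPotential (s : ℝ) (f : ℝ → ℝ) (g : Lp ℂ 2 (volume : Measure ℝ)) : Prop :=
  ∃ F : Lp ℂ 2 (volume : Measure ℝ), (∀ᵐ x, F x = (f x : ℂ)) ∧
    TemperedDistribution.besselPotential ℝ ℂ s (F : 𝓢'(ℝ, ℂ)) = (g : 𝓢'(ℝ, ℂ))

/-- `f ∈ C¹([0,T]; H^s(ℝ))` for `s ≥ 0`, where `f t x` is the value at time `t` and position `x`.
The Bessel potential of order `s` is an isometry of `H^s(ℝ)` into `L²(ℝ)`, so the curve
`t ↦ f t` is continuously differentiable in the norm of `H^s(ℝ)` if and only if the curve of its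
Bessel potentials is continuously differentiable in `L²(ℝ)` (one-sided at the end points). -/
def MemC1Sobolev (T s : ℝ) (f : ℝ → ℝ → ℝ) : Prop :=
  ∃ g : ℝ → Lp ℂ 2 (volume : Measure ℝ), ContDiffOn ℝ 1 g (Icc 0 T) ∧
    ∀ t ∈ Icc 0 T, HasBesselPotential s (f t) (g t)

/-- The equation of state `p = A ρ^γ`. -/
def pressure (A γ r : ℝ) : ℝ := A * r ^ γ

/-- `(ρ, u)` solves on `[0,T]` the Cauchy problem for the one-dimensional isentropic compressible
Navier–Stokes equations with viscosity coefficients `μ`, `lam` and pressure `p = A ρ^γ`,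
`ρ_t + (ρ u)_x = 0`, `(ρ u)_t + (ρ u²)_x + p_x = μ u_xx + (μ + lam) u_xx`,
and belongs to `C¹([0,T]; H^m(ℝ))`. At each time `t ∈ (0,T)` the equations hold in the sense of
distributions in `x`; in particular, classical (pointwise) solutions in this class are included. -/
structure IsSolution (μ lam A γ m T : ℝ) (ρ₀ u₀ : ℝ → ℝ) (ρ u : ℝ → ℝ → ℝ) : Prop where
  density_mem : MemC1Sobolev T m ρ
  velocity_mem : MemC1Sobolev T m u
  continuity_eq : ∀ φ : ℝ → ℝ, ContDiff ℝ ∞ φ → HasCompactSupport φ → ∀ t ∈ Ioo 0 T,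
    HasDerivAt (fun s => ∫ x, ρ s x * φ x) (∫ x, ρ t x * u t x * deriv φ x) t
  momentum_eq : ∀ φ : ℝ → ℝ, ContDiff ℝ ∞ φ → HasCompactSupport φ → ∀ t ∈ Ioo 0 T,
    HasDerivAt (fun s => ∫ x, ρ s x * u s x * φ x)
      ((∫ x, (ρ t x * u t x ^ 2 + pressure A γ (ρ t x)) * deriv φ x)
        + (μ + (μ + lam)) * ∫ x, u t x * deriv (deriv φ) x) t
  density_init : ∀ᵐ x, ρ 0 x = ρ₀ x
  velocity_init : ∀ᵐ x, u 0 x = u₀ x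

/-- The condition on the initial data near the left end point of `(0,1)`. -/
def LeftCondition (ρ₀ u₀ : ℝ → ℝ) : Prop :=
  ∃ l₁ l₃ : ℝ, 0 < l₁ ∧ 0 < l₃ ∧ l₃ < 1 ∧
    (∀ x ∈ Ioo 0 l₃, l₁ ≤ deriv ρ₀ x / ρ₀ x) ∧
    u₀ l₃ < 0 ∧ ∀ x ∈ Ioo 0 l₃, u₀ x ≤ 0

/-- The condition on the initial data near the right end point of `(0,1)`. -/
def RightCondition (ρ₀ u₀ : ℝ → ℝ) : Prop :=
  ∃ l₂ l₄ : ℝ, 0 < l₂ ∧ 0 < l₄ ∧ l₄ < 1 ∧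
    (∀ x ∈ Ioo l₄ 1, deriv ρ₀ x / ρ₀ x ≤ -l₂) ∧
    0 < u₀ l₄ ∧ ∀ x ∈ Ioo l₄ 1, 0 ≤ u₀ x

end IsentropicNS

end

/-! The contradiction sits at the vacuum interface. In the vacuum the momentum equation reduces to
`u_xx = 0`, so `u` is affine on a half-line; as it vanishes at infinity, both `u` and `u_x` are zero
up to and including the interface, which therefore never moves (`interface_stationary`).

Inside the fluid the opposite happens. Along trajectories `log ρ` has time derivative `-u_x`, and
`u_x` is Lipschitz in `x`, so the bound on the logarithmic derivative of `ρ₀` keeps `ρ` increasing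
near the left end for a short time (`density_monotoneOn`). Then `p_x ≥ 0` and `ρ (u_t + u u_x) ≤ ν
u_xx`: `u` is a subsolution of a parabolic equation whose coefficient `ρ` degenerates at the
interface but stays bounded. The maximum principle gives `u ≤ 0`, and a Hopf-type exponential
barrier (`le_barrier`) gives `u ≤ -ε (exp (k x) - 1)` at some positive time, which contradicts `u_x
= 0` at the interface (`not_leftCondition`). The right end follows by reflection.

This argument needs pointwise equations. Sobolev embedding (`MemC1Sobolev.exists_curve`) supplies
`C¹` curves of functions bounded with their `x`-derivatives; the distributional momentum equation
then shows that `u_xx` exists, is continuous and is bounded (`exists_strong`). -/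

open Filter Topology FourierTransform BoundedContinuousFunction

/-! ### Sobolev embedding by Fourier integrals -/

namespace IsentropicNS

noncomputable section

/-- The operator `g ↦ 𝓕⁻¹ (a · 𝓕 g)` from `L²` to bounded continuous functions, for `a ∈ L²`. -/
def fourierMultiplierL2 (a : Lp ℂ 2 (volume : Measure ℝ)) :
    Lp ℂ 2 (volume : Measure ℝ) →L[ℂ] (ℝ →ᵇ ℂ) :=
  (Real.Lp.fourierTransformInvCLM (V := ℝ) (E := ℂ)) ∘L
    ((ContinuousLinearMap.mul ℂ ℂ).holderL volume 2 2 1 a) ∘L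
    ((Lp.fourierTransformₗᵢ ℝ ℂ).toContinuousLinearEquiv :
      Lp ℂ 2 (volume : Measure ℝ) →L[ℂ] Lp ℂ 2 (volume : Measure ℝ))

lemma fourierMultiplierL2_apply {k : ℝ → ℂ} (hk : MemLp k 2)
    (g : Lp ℂ 2 (volume : Measure ℝ)) (x : ℝ) :
    fourierMultiplierL2 (hk.toLp k) g x = 𝓕⁻ (fun ξ => k ξ * (𝓕 g : Lp ℂ 2 (volume : Measure ℝ)) ξ) x := by
  have h : fourierMultiplierL2 (hk.toLp k) g x =
      𝓕⁻ (((ContinuousLinearMap.mul ℂ ℂ).holder 1 (hk.toLp k)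
        (𝓕 g : Lp ℂ 2 (volume : Measure ℝ)) : Lp ℂ 1 (volume : Measure ℝ)) : ℝ → ℂ) x :=
    Real.Lp.fourierTransformInv_apply _ x
  rw [h]
  apply Real.fourierInv_congr_ae
  filter_upwards [(ContinuousLinearMap.mul ℂ ℂ).coeFn_holder (r := 1) (hk.toLp k)
    (𝓕 g : Lp ℂ 2 (volume : Measure ℝ)), hk.coeFn_toLp] with ξ h1 h2
  rw [h1, h2]; rfl

lemma hasDerivAt_fourierInv {f : ℝ → ℂ} (hf : Integrable f) (hf' : Integrable (fun x : ℝ => x • f x))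
    (w : ℝ) : HasDerivAt (𝓕⁻ f) (𝓕⁻ (fun x : ℝ => (2 * Real.pi * Complex.I * x) * f x) w) w := by
  have h := (Real.hasDerivAt_fourier hf hf' (-w)).scomp w (hasDerivAt_neg w)
  have e : 𝓕⁻ f = (𝓕 f) ∘ Neg.neg := by
    ext x; exact Real.fourierInv_eq_fourier_neg f x
  rw [e]
  convert! h using 1
  rw [Real.fourierInv_eq_fourier_neg, Real.fourier_eq, Real.fourier_eq, ← integral_smul]
  congr 1; ext v
  simp only [smul_eq_mul, neg_smul, one_smul, Circle.smul_def]
  ring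

lemma tendsto_fourierInv_cocompact (f : ℝ → ℂ) : Tendsto (𝓕⁻ f) (cocompact ℝ) (𝓝 0) := by
  have e : 𝓕⁻ f = (𝓕 f) ∘ Neg.neg := by
    ext x; exact Real.fourierInv_eq_fourier_neg f x
  rw [e]
  exact (Real.zero_at_infty_fourier f).comp (Homeomorph.neg ℝ).isClosedEmbedding.tendsto_cocompact

lemma memLp_bessel {s : ℝ} (hs : 1 / 2 < s) :
    MemLp (fun x : ℝ ↦ (((1 + ‖x‖ ^ 2) ^ (-s / 2) : ℝ) : ℂ)) 2 := by
  have hc : Continuous (fun x : ℝ ↦ (1 + ‖x‖ ^ 2) ^ (-s / 2)) := by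
    refine Continuous.rpow_const (by fun_prop) fun x => Or.inl (by positivity)
  refine MemLp.ofReal (K := ℂ) (f := fun x : ℝ ↦ (1 + ‖x‖ ^ 2) ^ (-s / 2)) ?_
  rw [memLp_two_iff_integrable_sq hc.aestronglyMeasurable]
  refine (integrable_rpow_neg_one_add_norm_sq (E := ℝ) (r := 2 * s) (by simp; linarith)).congr ?_
  filter_upwards with x
  rw [← Real.rpow_mul_natCast (by positivity)]
  congr 1; push_cast; ring

/-- The factor `|x|` costs one power of `(1 + x²)^(1/2)`, which reduces the claim to `memLp_bessel`
at order `s - 1`. -/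
lemma memLp_bessel_deriv {s : ℝ} (hs : 3 / 2 < s) :
    MemLp (fun x : ℝ ↦ (2 * Real.pi * Complex.I * x) * (((1 + ‖x‖ ^ 2) ^ (-s / 2) : ℝ) : ℂ)) 2 := by
  have hc : Continuous (fun x : ℝ ↦ (1 + ‖x‖ ^ 2) ^ (-s / 2)) := by
    refine Continuous.rpow_const (by fun_prop) fun x => Or.inl (by positivity)
  refine MemLp.of_le_mul (c := 2 * Real.pi) (memLp_bessel (s := s - 1) (by linarith))
    (by fun_prop) ?_
  filter_upwards with x
  have h1 : ‖x‖ ≤ (1 + ‖x‖ ^ 2) ^ (1 / 2 : ℝ) := by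
    rw [← Real.sqrt_eq_rpow]
    apply Real.le_sqrt_of_sq_le; linarith
  have h2 : (1 + ‖x‖ ^ 2) ^ (-(s - 1) / 2) =
      (1 + ‖x‖ ^ 2) ^ (1 / 2 : ℝ) * (1 + ‖x‖ ^ 2) ^ (-s / 2) := by
    rw [← Real.rpow_add (by positivity)]; congr 1; ring
  rw [h2]
  have h3 : 0 ≤ (1 + ‖x‖ ^ 2) ^ (-s / 2) := by positivity
  have h4 : 0 ≤ (1 + ‖x‖ ^ 2) ^ (1 / 2 : ℝ) := by positivity
  simp only [norm_mul, Complex.norm_real, Complex.norm_I, Complex.norm_ofNat]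
  rw [Real.norm_of_nonneg h3, Real.norm_of_nonneg h4, Real.norm_of_nonneg Real.pi_pos.le]
  have := mul_le_mul_of_nonneg_right h1 h3
  have hp := Real.pi_pos
  nlinarith

/-- A function whose Bessel potential of order `s > 1/2` is `g ∈ L²` agrees almost everywhere
with a Fourier integral. -/
lemma HasBesselPotential.ae_eq {s : ℝ} (hs : 1 / 2 < s) {f : ℝ → ℝ}
    {g : Lp ℂ 2 (volume : Measure ℝ)} (h : HasBesselPotential s f g) :
    ∀ᵐ x, (f x : ℂ) = fourierMultiplierL2 ((memLp_bessel hs).toLp _) g x := by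
  obtain ⟨F, hF, hg⟩ := h
  set k : ℝ → ℂ := fun x : ℝ ↦ (((1 + ‖x‖ ^ 2) ^ (-s / 2) : ℝ) : ℂ) with hk
  set Gh : Lp ℂ 2 (volume : Measure ℝ) := 𝓕 g with hGh
  have hinteg : Integrable (fun ξ => k ξ * Gh ξ) :=
    (memLp_bessel hs).integrable_mul (Lp.memLp Gh)
  -- Tested on Schwartz functions, `F` equals the inverse transform of `k · 𝓕 g`. Since this product
  -- is integrable, Fubini moves the transform from `φ` onto it.
  have key : ∀ φ : 𝓢(ℝ, ℂ), ∫ x, φ x • F x = ∫ x, φ x • 𝓕⁻ (fun ξ => k ξ * Gh ξ) x := by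
    intro φ
    have h1 : (F : 𝓢'(ℝ, ℂ)) = TemperedDistribution.besselPotential ℝ ℂ (-s) (g : 𝓢'(ℝ, ℂ)) :=
      ((TemperedDistribution.besselPotential_neg_apply_eq_iff s _ _).2 hg).symm
    have h2 : (F : 𝓢'(ℝ, ℂ)) = 𝓕⁻ (TemperedDistribution.smulLeftCLM ℂ k (Gh : 𝓢'(ℝ, ℂ))) := by
      rw [h1, ← Lp.fourier_toTemperedDistribution_eq]
      exact TemperedDistribution.fourierMultiplierCLM_apply _ _
    have hkt : k.HasTemperateGrowth := by fun_prop
    have h3 : (F : 𝓢'(ℝ, ℂ)) φ = ∫ x, (𝓕⁻ φ) x • (k x * Gh x) := by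
      rw [h2, TemperedDistribution.fourierInv_apply, TemperedDistribution.smulLeftCLM_apply_apply,
        Lp.toTemperedDistribution_apply]
      congr 1; ext x
      rw [SchwartzMap.smulLeftCLM_apply_apply hkt]
      simp only [smul_eq_mul]; ring
    rw [← Lp.toTemperedDistribution_apply, h3]
    have hflip : (-innerₗ ℝ : ℝ →ₗ[ℝ] ℝ →ₗ[ℝ] ℝ).flip = -innerₗ ℝ := by
      ext; simp
    have := VectorFourier.integral_fourierIntegral_smul_eq_flip (μ := volume) (ν := volume)
      (e := 𝐞) (L := -innerₗ ℝ) Real.continuous_fourierChar (by simp; fun_prop) φ.integrable hinteg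
    rw [hflip] at this
    rw [SchwartzMap.fourierInv_coe]
    exact this
  have hF2 : ∀ᵐ x, F x = 𝓕⁻ (fun ξ => k ξ * Gh ξ) x := by
    have hc : Continuous (𝓕⁻ (fun ξ => k ξ * Gh ξ)) := by
      have e : 𝓕⁻ (fun ξ => k ξ * Gh ξ) = fourierMultiplierL2 ((memLp_bessel hs).toLp _) g := by
        ext x; rw [fourierMultiplierL2_apply]
      rw [e]; exact map_continuous _
    refine ae_eq_of_integral_contDiff_smul_eq ((Lp.memLp F).locallyIntegrable (by norm_num))
      hc.locallyIntegrable fun φ hφ hφc => ?_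
    have hg₁ : HasCompactSupport (Complex.ofRealCLM ∘ φ) := hφc.comp_left rfl
    have hg₂ : ContDiff ℝ ∞ (Complex.ofRealCLM ∘ φ) := by fun_prop
    simpa using key (hg₁.toSchwartzMap hg₂)
  filter_upwards [hF, hF2] with x h1 h2
  rw [fourierMultiplierL2_apply, ← h1, h2]

lemma integrable_bessel_mul {s : ℝ} (hs : 3 / 2 < s) (G : Lp ℂ 2 (volume : Measure ℝ)) :
    Integrable (fun ξ : ℝ => ξ • ((((1 + ‖ξ‖ ^ 2) ^ (-s / 2) : ℝ) : ℂ) * G ξ)) := by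
  have h := ((memLp_bessel_deriv hs).integrable_mul (Lp.memLp G)).const_mul
    (2 * Real.pi * Complex.I)⁻¹
  refine h.congr (Eventually.of_forall fun ξ => ?_)
  have hp : (Real.pi : ℂ) ≠ 0 := by exact_mod_cast Real.pi_ne_zero
  have hI := Complex.I_ne_zero
  simp only [Pi.mul_apply, Complex.real_smul]
  field_simp

/-- The Sobolev embedding of `C¹([0,T]; H^s(ℝ))`, `s > 3/2`, into `C¹([0,T]; C¹_b(ℝ))`, with
functions that vanish at infinity. -/
theorem MemC1Sobolev.exists_curve {T s : ℝ} (hs : 3 / 2 < s) {f : ℝ → ℝ → ℝ}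
    (hf : MemC1Sobolev T s f) :
    ∃ F Fx : ℝ → (ℝ →ᵇ ℝ), ContDiffOn ℝ 1 F (Icc 0 T) ∧ ContDiffOn ℝ 1 Fx (Icc 0 T) ∧
      ∀ t ∈ Icc 0 T, (∀ᵐ x, f t x = F t x) ∧ (∀ x, HasDerivAt (F t) (Fx t x) x) ∧
        Tendsto (F t) (cocompact ℝ) (𝓝 0) := by
  obtain ⟨g, hg, hfg⟩ := hf
  have hs' : 1 / 2 < s := by linarith
  -- Every map applied to `g` is continuous and linear over `ℝ`, so regularity in time is inherited
  -- by composition.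
  let R : (ℝ →ᵇ ℂ) →L[ℝ] (ℝ →ᵇ ℝ) := Complex.reCLM.compLeftContinuousBounded ℝ
  let J (a : Lp ℂ 2 (volume : Measure ℝ)) : Lp ℂ 2 (volume : Measure ℝ) →L[ℝ] (ℝ →ᵇ ℝ) :=
    R ∘L (fourierMultiplierL2 a).restrictScalars ℝ
  have hJ : ∀ a g x, J a g x = (fourierMultiplierL2 a g x).re := fun _ _ _ => rfl
  refine ⟨fun t => J ((memLp_bessel hs').toLp _) (g t),
    fun t => J ((memLp_bessel_deriv hs).toLp _) (g t),
    (J _).contDiff.comp_contDiffOn hg, (J _).contDiff.comp_contDiffOn hg, fun t ht => ⟨?_, ?_, ?_⟩⟩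
  · filter_upwards [(hfg t ht).ae_eq hs'] with x hx
    rw [hJ, ← hx, Complex.ofReal_re]
  · intro x
    have h := hasDerivAt_fourierInv ((memLp_bessel hs').integrable_mul
      (Lp.memLp (𝓕 (g t) : Lp ℂ 2 (volume : Measure ℝ)))) (integrable_bessel_mul hs _) x
    have h2 := Complex.reCLM.hasFDerivAt.comp_hasDerivAt x h
    convert! h2 using 1
    · ext y
      rw [hJ, fourierMultiplierL2_apply]; rfl
    · rw [hJ, fourierMultiplierL2_apply]
      simp only [Complex.reCLM_apply, Pi.mul_apply, mul_assoc]
  · have h := (Complex.continuous_re.tendsto 0).comp (tendsto_fourierInv_cocompact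
      (fun ξ => (((1 + ‖ξ‖ ^ 2) ^ (-s / 2) : ℝ) : ℂ) *
        (𝓕 (g t) : Lp ℂ 2 (volume : Measure ℝ)) ξ))
    rw [Complex.zero_re] at h
    refine h.congr fun x => ?_
    rw [hJ, fourierMultiplierL2_apply]; rfl

end

end IsentropicNS

/-! ### Calculus of one variable -/

namespace IsentropicNS

section Calculus

/-- Grönwall in both time directions: `d² exp (2Kt)` increases and `d² exp (-2Kt)` decreases, so `s`
and `r` may come in either order. -/
lemma abs_le_exp_mul_abs {T K : ℝ} {d d' : ℝ → ℝ} (hK : 0 ≤ K) (hc : ContinuousOn d (Icc 0 T))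
    (hd : ∀ t ∈ Ioo 0 T, HasDerivAt d (d' t) t) (hb : ∀ t ∈ Ioo 0 T, |d' t| ≤ K * |d t|)
    {s r : ℝ} (hs : s ∈ Icc 0 T) (hr : r ∈ Icc 0 T) : |d s| ≤ Real.exp (K * T) * |d r| := by
  have hderiv : ∀ c, ∀ t ∈ Ioo 0 T, HasDerivAt (fun t => d t ^ 2 * Real.exp (2 * (c * t)))
      (2 * (d t * d' t + c * d t ^ 2) * Real.exp (2 * (c * t))) t := by
    intro c t ht
    have h1 := (hd t ht).pow 2
    have h2 : HasDerivAt (fun t => Real.exp (2 * (c * t)))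
        (Real.exp (2 * (c * t)) * (2 * (c * 1))) t :=
      (((hasDerivAt_id t).const_mul c).const_mul 2).exp
    convert! h1.mul h2 using 1
    simp; ring
  have hcont : ∀ c, ContinuousOn (fun t => d t ^ 2 * Real.exp (2 * (c * t))) (Icc 0 T) := by
    intro c; fun_prop
  have hprod : ∀ t ∈ Ioo 0 T, |d t * d' t| ≤ K * d t ^ 2 := by
    intro t ht
    rw [abs_mul, ← sq_abs (d t)]
    nlinarith [hb t ht, abs_nonneg (d t)]
  have hmono : MonotoneOn (fun t => d t ^ 2 * Real.exp (2 * (K * t))) (Icc 0 T) := by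
    refine monotoneOn_of_hasDerivWithinAt_nonneg (convex_Icc 0 T) (hcont K)
      (f' := fun t => 2 * (d t * d' t + K * d t ^ 2) * Real.exp (2 * (K * t))) ?_ ?_
    · intro t ht; rw [interior_Icc] at ht ⊢; exact (hderiv K t ht).hasDerivWithinAt
    · intro t ht; rw [interior_Icc] at ht
      have := neg_abs_le (d t * d' t)
      have := hprod t ht
      have h0 : 0 ≤ d t * d' t + K * d t ^ 2 := by linarith
      positivity
  have hanti : AntitoneOn (fun t => d t ^ 2 * Real.exp (2 * (-K * t))) (Icc 0 T) := by
    refine antitoneOn_of_hasDerivWithinAt_nonpos (convex_Icc 0 T) (hcont (-K))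
      (f' := fun t => 2 * (d t * d' t + -K * d t ^ 2) * Real.exp (2 * (-K * t))) ?_ ?_
    · intro t ht; rw [interior_Icc] at ht ⊢; exact (hderiv (-K) t ht).hasDerivWithinAt
    · intro t ht; rw [interior_Icc] at ht
      have := le_abs_self (d t * d' t)
      have := hprod t ht
      have h0 : d t * d' t + -K * d t ^ 2 ≤ 0 := by linarith
      exact mul_nonpos_of_nonpos_of_nonneg (by linarith) (Real.exp_pos _).le
  have hsq : d s ^ 2 ≤ Real.exp (2 * (K * T)) * d r ^ 2 := by
    rcases le_total s r with hsr | hsr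
    · have h := hmono hs hr hsr
      simp only at h
      have h1 : (1 : ℝ) ≤ Real.exp (2 * (K * s)) := Real.one_le_exp (by have := hs.1; positivity)
      have h2 : Real.exp (2 * (K * r)) ≤ Real.exp (2 * (K * T)) :=
        Real.exp_le_exp.2 (by have := mul_le_mul_of_nonneg_left hr.2 hK; linarith)
      nlinarith [sq_nonneg (d s), sq_nonneg (d r)]
    · have h := hanti hr hs hsr
      simp only at h
      have h1 : Real.exp (2 * (-K * r)) ≤ 1 :=
        Real.exp_le_one_iff.2 (by have := mul_nonneg hK hr.1; linarith)
      have h2 : Real.exp (-(2 * (K * T))) ≤ Real.exp (2 * (-K * s)) :=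
        Real.exp_le_exp.2 (by have := mul_le_mul_of_nonneg_left hs.2 hK; linarith)
      have h3 : d s ^ 2 * Real.exp (-(2 * (K * T))) ≤ d r ^ 2 := by
        nlinarith [sq_nonneg (d s), sq_nonneg (d r)]
      rw [Real.exp_neg, ← div_eq_mul_inv, div_le_iff₀ (Real.exp_pos _)] at h3
      linarith
  refine abs_le_of_sq_le_sq' ?_ (by positivity) |> abs_le.2
  rw [mul_pow, sq_abs, ← Real.exp_nat_mul]
  exact_mod_cast hsq

/-- A change of sign would produce a zero, and by Grönwall a zero at one time propagates to all
times. -/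
lemma pos_of_abs_deriv_le {T K : ℝ} {d d' : ℝ → ℝ} (hK : 0 ≤ K) (hc : ContinuousOn d (Icc 0 T))
    (hd : ∀ t ∈ Ioo 0 T, HasDerivAt d (d' t) t) (hb : ∀ t ∈ Ioo 0 T, |d' t| ≤ K * |d t|)
    {s r : ℝ} (hs : s ∈ Icc 0 T) (hr : r ∈ Icc 0 T) (hpos : 0 < d s) : 0 < d r := by
  by_contra! h
  obtain ⟨z, hz, hz0⟩ := isPreconnected_Icc.intermediate_value hr hs hc ⟨h, hpos.le⟩
  have := abs_le_exp_mul_abs hK hc hd hb hs hz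
  rw [hz0, abs_zero, mul_zero] at this
  exact hpos.ne' (abs_nonpos_iff.1 this)

lemma eq_of_hasDerivAt_zero {f : ℝ → ℝ} {a x y : ℝ} (h : ∀ z < a, HasDerivAt f 0 z)
    (hx : x < a) (hy : y < a) : f x = f y := by
  wlog hxy : x < y generalizing x y
  · rcases eq_or_lt_of_le (not_lt.1 hxy) with e | e
    · rw [e]
    · exact (this hy hx e).symm
  obtain ⟨c, -, hc⟩ := exists_hasDerivAt_eq_slope f (fun _ => 0) hxy
    (fun z hz => (h z (hz.2.trans_lt hy)).continuousAt.continuousWithinAt)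
    (fun z hz => h z (hz.2.trans hy))
  have := (sub_pos.2 hxy).ne'
  field_simp at hc
  linarith

/-- A function which is affine on a left half-line and vanishes at `-∞` is zero there. -/
lemma eq_zero_of_deriv_deriv_zero {f f' : ℝ → ℝ} {a : ℝ} (hf : ∀ x, HasDerivAt f (f' x) x)
    (hf'c : Continuous f') (hf' : ∀ x < a, HasDerivAt f' 0 x) (hlim : Tendsto f atBot (𝓝 0)) :
    ∀ x ≤ a, f x = 0 ∧ f' x = 0 := by
  have h1 : ∀ x < a, f' x = 0 := by
    intro x hx
    -- The slope is constant on the half-line, so it equals every unit increment of `f`; these tend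
    -- to zero at `-∞`.
    have hstep : ∀ y < a, f y - f (y - 1) = f' x := by
      intro y hy
      obtain ⟨c, hc, hc'⟩ := exists_hasDerivAt_eq_slope f f' (sub_one_lt y)
        (fun z _ => (hf z).continuousAt.continuousWithinAt) (fun z _ => hf z)
      rw [eq_of_hasDerivAt_zero hf' hx (hc.2.trans hy), hc']
      ring
    have ht : Tendsto (fun y => f y - f (y - 1)) atBot (𝓝 (0 - 0)) :=
      hlim.sub (hlim.comp (tendsto_atBot_add_const_right _ (-1) tendsto_id))
    rw [sub_zero] at ht
    refine tendsto_nhds_unique (tendsto_const_nhds.congr' ?_) ht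
    filter_upwards [Iio_mem_atBot a] with y hy
    exact (hstep y hy).symm
  have h2 : ∀ x < a, f x = 0 := by
    intro x hx
    refine tendsto_nhds_unique (tendsto_const_nhds.congr' ?_) hlim
    filter_upwards [Iio_mem_atBot a] with y hy
    exact eq_of_hasDerivAt_zero (fun z hz => by simpa [h1 z hz] using hf z) hx hy
  have hfc : Continuous f := continuous_iff_continuousAt.2 fun x => (hf x).continuousAt
  have hcl : ∀ {g : ℝ → ℝ}, Continuous g → (∀ x < a, g x = 0) → ∀ x ≤ a, g x = 0 := by
    intro g hg h x hx
    have : closure (Iio a) ⊆ {x | g x = 0} :=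
      closure_minimal h (isClosed_eq hg continuous_const)
    rw [closure_Iio] at this
    exact this hx
  exact fun x hx => ⟨hcl hfc h2 x hx, hcl hf'c h1 x hx⟩

/-- The second derivative is nonpositive at a local maximum. -/
lemma second_deriv_nonpos_of_isLocalMax {f f' : ℝ → ℝ} {f'' x : ℝ} (hf : ∀ y, HasDerivAt f (f' y) y)
    (hf' : HasDerivAt f' f'' x) (hmax : IsLocalMax f x) : f'' ≤ 0 := by
  by_contra! h
  have h0 : f' x = 0 := hmax.hasDerivAt_eq_zero (hf x)
  have hpos : ∀ᶠ y in 𝓝[>] x, 0 < f' y := by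
    have := (hasDerivAt_iff_tendsto_slope.1 hf').eventually (lt_mem_nhds h)
    have := this.filter_mono (nhdsWithin_mono x (fun y (hy : x < y) => hy.ne'))
    filter_upwards [this, self_mem_nhdsWithin] with y hy hxy
    rw [slope_def_field, h0, sub_zero] at hy
    exact (div_pos_iff_of_pos_right (sub_pos.2 hxy)).1 hy
  have hle : ∀ᶠ y in 𝓝[>] x, f y ≤ f x := hmax.filter_mono nhdsWithin_le_nhds
  obtain ⟨b, hb, hball⟩ := mem_nhdsGT_iff_exists_Ioo_subset.1 (hpos.and hle)
  have hxb : x < b := hb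
  obtain ⟨c, hc, hc'⟩ := exists_hasDerivAt_eq_slope f f' (show x < (x + b) / 2 by linarith)
    (fun z _ => (hf z).continuousAt.continuousWithinAt) (fun z _ => hf z)
  have h1 : 0 < f' c := (hball ⟨hc.1, by linarith [hc.2]⟩).1
  have h2 : f ((x + b) / 2) ≤ f x := (hball ⟨by linarith, by linarith⟩).2
  rw [hc', div_pos_iff_of_pos_right (by linarith)] at h1
  linarith

/-- A left-sided local maximum has nonnegative derivative. -/
lemma deriv_nonneg_of_eventually_le {f : ℝ → ℝ} {f' t : ℝ} (hf : HasDerivAt f f' t)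
    (h : ∀ᶠ s in 𝓝[<] t, f s ≤ f t) : 0 ≤ f' := by
  have h1 : Tendsto (slope f t) (𝓝[<] t) (𝓝 f') := (hasDerivAt_iff_tendsto_slope.1 hf).mono_left
    (nhdsWithin_mono t (fun y (hy : y < t) => hy.ne))
  refine ge_of_tendsto h1 ?_
  filter_upwards [h, self_mem_nhdsWithin] with s hs hst
  rw [slope_def_field]
  exact div_nonneg_of_nonpos (by linarith) (by have : s < t := hst; linarith)

/-- A function bounded above by its value at `t` on the right has nonpositive derivative. -/
lemma deriv_nonpos_of_eventually_le {f : ℝ → ℝ} {f' t : ℝ} (hf : HasDerivAt f f' t)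
    (h : ∀ᶠ s in 𝓝[>] t, f s ≤ f t) : f' ≤ 0 := by
  have h1 : Tendsto (slope f t) (𝓝[>] t) (𝓝 f') := (hasDerivAt_iff_tendsto_slope.1 hf).mono_left
    (nhdsWithin_mono t (fun y (hy : t < y) => hy.ne'))
  refine le_of_tendsto h1 ?_
  filter_upwards [h, self_mem_nhdsWithin] with s hs hst
  rw [slope_def_field]
  exact div_nonpos_of_nonpos_of_nonneg (by linarith) (by have : t < s := hst; linarith)

end Calculus

/-! ### Trajectories and transport of the density -/

/-- `Z` is a trajectory of the velocity field `u` on `[0,T]`. -/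
structure IsTrajectory (T : ℝ) (u : ℝ → ℝ → ℝ) (Z : ℝ → ℝ) : Prop where
  continuousOn : ContinuousOn Z (Icc 0 T)
  hasDerivAt : ∀ t ∈ Ioo 0 T, HasDerivAt Z (u t (Z t)) t

/-- `ρ` solves the continuity equation with velocity `u`, written along trajectories; `ux` is the
spatial derivative of `u`, and `M` bounds `u` and `ux`. -/
structure IsTransported (T M : ℝ) (ρ u ux : ℝ → ℝ → ℝ) : Prop where
  continuousOn_density : ContinuousOn (Function.uncurry ρ) (Icc 0 T ×ˢ univ)
  continuousOn_velocity : ContinuousOn (Function.uncurry u) (Icc 0 T ×ˢ univ)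
  velocity_le : ∀ t ∈ Icc 0 T, ∀ x, |u t x| ≤ M
  gradient_le : ∀ t ∈ Icc 0 T, ∀ x, |ux t x| ≤ M
  hasDerivAt_velocity : ∀ t ∈ Icc 0 T, ∀ x, HasDerivAt (u t) (ux t x) x
  transport : ∀ Z : ℝ → ℝ, ∀ t ∈ Ioo 0 T, HasDerivAt Z (u t (Z t)) t →
    HasDerivAt (fun s => ρ s (Z s)) (-(ux t (Z t) * ρ t (Z t))) t

namespace IsTransported

variable {T M : ℝ} {ρ u ux : ℝ → ℝ → ℝ}

lemma nonneg_bound (h : IsTransported T M ρ u ux) (hT : 0 < T) : 0 ≤ M :=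
  (abs_nonneg _).trans (h.velocity_le 0 ⟨le_rfl, hT.le⟩ 0)

lemma abs_velocity_sub_le (h : IsTransported T M ρ u ux) {t : ℝ} (ht : t ∈ Icc 0 T) (x y : ℝ) :
    |u t x - u t y| ≤ M * |x - y| := by
  have := convex_univ.norm_image_sub_le_of_norm_hasDerivWithin_le (f := u t) (f' := ux t) (C := M)
    (fun z _ => (h.hasDerivAt_velocity t ht z).hasDerivWithinAt)
    (fun z _ => h.gradient_le t ht z) (mem_univ y) (mem_univ x)
  simpa [Real.norm_eq_abs] using this

/-- The velocity is globally bounded and Lipschitz in `x`, so Picard–Lindelöf on a ball of radius `M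
* T` covers all of `[0,T]`, forwards and backwards from `t`. -/
lemma exists_trajectory (h : IsTransported T M ρ u ux) (hT : 0 < T) {t : ℝ} (ht : t ∈ Icc 0 T)
    (x : ℝ) : ∃ Z, IsTrajectory T u Z ∧ Z t = x := by
  have hM := h.nonneg_bound hT
  have hPL : IsPicardLindelof u (tmin := 0) (tmax := T) ⟨t, ht⟩ x ⟨M * T, by positivity⟩ 0
      ⟨M, hM⟩ ⟨M, hM⟩ := by
    refine ⟨fun s hs => ?_, fun y _ => ?_, fun s hs y _ => ?_, ?_⟩
    · refine LipschitzOnWith.of_dist_le_mul fun y _ z _ => ?_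
      rw [Real.dist_eq, Real.dist_eq]
      exact h.abs_velocity_sub_le hs y z
    · exact h.continuousOn_velocity.comp (f := fun s => (s, y)) (by fun_prop)
        (fun s hs => ⟨hs, mem_univ _⟩)
    · exact h.velocity_le s hs y
    · simp only [NNReal.coe_zero, sub_zero]
      refine mul_le_mul_of_nonneg_left (max_le ?_ ?_) hM
      · linarith [ht.1]
      · exact ht.2
  obtain ⟨Z, hZ, hZ'⟩ := hPL.exists_eq_forall_mem_Icc_hasDerivWithinAt₀
  exact ⟨Z, ⟨fun s hs => (hZ' s hs).continuousWithinAt,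
    fun s hs => (hZ' s ⟨hs.1.le, hs.2.le⟩).hasDerivAt (Icc_mem_nhds hs.1 hs.2)⟩, hZ⟩

/-- The difference of two trajectories satisfies `|d'| ≤ M |d|`, so trajectories never cross. -/
lemma trajectory_lt (h : IsTransported T M ρ u ux) (hT : 0 < T) {Z W : ℝ → ℝ}
    (hZ : IsTrajectory T u Z) (hW : IsTrajectory T u W) {s r : ℝ} (hs : s ∈ Icc 0 T)
    (hr : r ∈ Icc 0 T) (hlt : Z s < W s) : Z r < W r := by
  refine sub_pos.1 (pos_of_abs_deriv_le (d := fun t => W t - Z t) (h.nonneg_bound hT)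
    (hW.continuousOn.sub hZ.continuousOn) (fun t ht => (hW.hasDerivAt t ht).sub (hZ.hasDerivAt t ht))
    (fun _ ht => h.abs_velocity_sub_le ⟨ht.1.le, ht.2.le⟩ _ _) hs hr (sub_pos.2 hlt))

lemma trajectory_sub_le (h : IsTransported T M ρ u ux) (hT : 0 < T) {Z W : ℝ → ℝ}
    (hZ : IsTrajectory T u Z) (hW : IsTrajectory T u W) {s r : ℝ} (hs : s ∈ Icc 0 T)
    (hr : r ∈ Icc 0 T) : |W s - Z s| ≤ Real.exp (M * T) * |W r - Z r| :=
  abs_le_exp_mul_abs (d := fun t => W t - Z t) (h.nonneg_bound hT)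
    (hW.continuousOn.sub hZ.continuousOn) (fun t ht => (hW.hasDerivAt t ht).sub (hZ.hasDerivAt t ht))
    (fun _ ht => h.abs_velocity_sub_le ⟨ht.1.le, ht.2.le⟩ _ _) hs hr

lemma continuousOn_comp_trajectory (h : IsTransported T M ρ u ux) {Z : ℝ → ℝ}
    (hZ : IsTrajectory T u Z) : ContinuousOn (fun t => ρ t (Z t)) (Icc 0 T) :=
  h.continuousOn_density.comp (f := fun t => (t, Z t)) (continuousOn_id.prodMk hZ.continuousOn)
    (fun _ hs => ⟨hs, mem_univ _⟩)

lemma density_pos (h : IsTransported T M ρ u ux) (hT : 0 < T) {Z : ℝ → ℝ}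
    (hZ : IsTrajectory T u Z) {s r : ℝ} (hs : s ∈ Icc 0 T) (hr : r ∈ Icc 0 T)
    (hpos : 0 < ρ s (Z s)) : 0 < ρ r (Z r) :=
  pos_of_abs_deriv_le (d := fun t => ρ t (Z t)) (h.nonneg_bound hT)
    (h.continuousOn_comp_trajectory hZ) (fun t ht => h.transport Z t ht (hZ.hasDerivAt t ht))
    (fun t ht => by
      rw [abs_neg, abs_mul]
      exact mul_le_mul_of_nonneg_right (h.gradient_le t ⟨ht.1.le, ht.2.le⟩ _) (abs_nonneg _))
    hs hr hpos

lemma density_eq_zero (h : IsTransported T M ρ u ux) (hT : 0 < T) {Z : ℝ → ℝ}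
    (hZ : IsTrajectory T u Z) {s r : ℝ} (hs : s ∈ Icc 0 T) (hr : r ∈ Icc 0 T)
    (h0 : ρ s (Z s) = 0) : ρ r (Z r) = 0 := by
  have := abs_le_exp_mul_abs (d := fun t => ρ t (Z t)) (h.nonneg_bound hT)
    (h.continuousOn_comp_trajectory hZ) (fun t ht => h.transport Z t ht (hZ.hasDerivAt t ht))
    (fun t ht => by
      rw [abs_neg, abs_mul]
      exact mul_le_mul_of_nonneg_right (h.gradient_le t ⟨ht.1.le, ht.2.le⟩ _) (abs_nonneg _))
    hr hs
  rw [h0, abs_zero, mul_zero] at this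
  exact abs_nonpos_iff.1 this

lemma density_nonneg (h : IsTransported T M ρ u ux) (hT : 0 < T) (h0 : ∀ x, 0 ≤ ρ 0 x) {t : ℝ}
    (ht : t ∈ Icc 0 T) (x : ℝ) : 0 ≤ ρ t x := by
  obtain ⟨Z, hZ, rfl⟩ := h.exists_trajectory hT ht x
  have h0T : (0 : ℝ) ∈ Icc 0 T := ⟨le_rfl, hT.le⟩
  rcases (h0 (Z 0)).eq_or_lt with e | e
  · exact (h.density_eq_zero hT hZ h0T ht e.symm).ge
  · exact (h.density_pos hT hZ h0T ht e).le

lemma trajectory_sub_initial_le (h : IsTransported T M ρ u ux) {Z : ℝ → ℝ}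
    (hZ : IsTrajectory T u Z) {t : ℝ} (ht : t ∈ Ioo 0 T) : |Z t - Z 0| ≤ M * t := by
  obtain ⟨c, hc, hc'⟩ := exists_hasDerivAt_eq_slope Z (fun s => u s (Z s)) ht.1
    (hZ.continuousOn.mono (Icc_subset_Icc le_rfl ht.2.le))
    (fun s hs => hZ.hasDerivAt s ⟨hs.1, hs.2.trans ht.2⟩)
  have := h.velocity_le c ⟨hc.1.le, (hc.2.trans ht.2).le⟩ (Z c)
  rwa [hc', sub_zero, abs_div, abs_of_pos ht.1, div_le_iff₀ ht.1] at this

end IsTransported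

end IsentropicNS

/-! ### Vacuum interface, monotone density and barrier comparison -/

namespace IsentropicNS

/-- A pointwise solution of the equations with a velocity that vanishes at infinity and has a
Lipschitz spatial derivative `ux`. -/
structure IsStrongSolution (ν A γ T M : ℝ) (ρ u ux : ℝ → ℝ → ℝ) : Prop
    extends IsTransported T M ρ u ux where
  tendsto_velocity : ∀ t ∈ Icc 0 T, Tendsto (u t) (cocompact ℝ) (𝓝 0)
  gradient_lipschitz : ∀ t ∈ Ioo 0 T, ∀ x y, |ux t x - ux t y| ≤ M * |x - y|
  momentum : ∀ t ∈ Ioo 0 T, ∀ x, ∃ ρx ut uxx : ℝ, HasDerivAt (ρ t) ρx x ∧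
    HasDerivAt (fun s => u s x) ut t ∧ HasDerivAt (ux t) uxx x ∧
    ρ t x * (ut + u t x * ux t x) + A * γ * ρ t x ^ (γ - 1) * ρx = ν * uxx

namespace IsStrongSolution

variable {ν A γ T M : ℝ} {ρ u ux : ℝ → ℝ → ℝ}

/-- The velocity and its gradient vanish to the left of a vacuum interface. -/
lemma velocity_eq_zero_of_vacuum (h : IsStrongSolution ν A γ T M ρ u ux) (hν : 0 < ν) (hγ : 1 < γ)
    {t a : ℝ} (ht : t ∈ Ioo 0 T) (hvac : ∀ x < a, ρ t x = 0) :
    ∀ x ≤ a, u t x = 0 ∧ ux t x = 0 := by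
  have htI : t ∈ Icc 0 T := ⟨ht.1.le, ht.2.le⟩
  refine eq_zero_of_deriv_deriv_zero (h.hasDerivAt_velocity t htI) ?_ (fun x hx => ?_)
    ((h.tendsto_velocity t htI).mono_left atBot_le_cocompact)
  · refine continuous_iff_continuousAt.2 fun x => ?_
    obtain ⟨_, _, uxx, _, _, hu, _⟩ := h.momentum t ht x
    exact hu.continuousAt
  · obtain ⟨ρx, ut, uxx, _, _, hu, he⟩ := h.momentum t ht x
    rw [hvac x hx, Real.zero_rpow (by linarith)] at he
    have : uxx = 0 := by
      rcases mul_eq_zero.1 (show ν * uxx = 0 by linarith) with h | h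
      · exact absurd h hν.ne'
      · exact h
    rwa [this] at hu

/-- The left vacuum interface does not move. -/
lemma interface_stationary (h : IsStrongSolution ν A γ T M ρ u ux) (hν : 0 < ν) (hγ : 1 < γ)
    (hT : 0 < T) (hvac : ∀ x < 0, ρ 0 x = 0) :
    (∀ t ∈ Ioo 0 T, u t 0 = 0 ∧ ux t 0 = 0) ∧
      ∃ Z, IsTrajectory T u Z ∧ ∀ t ∈ Icc 0 T, Z t = 0 := by
  have h0T : (0 : ℝ) ∈ Icc 0 T := ⟨le_rfl, hT.le⟩
  obtain ⟨Z, hZ, hZ0⟩ := h.exists_trajectory hT h0T 0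
  -- Points to the left of `Z t` trace back to negative initial positions, hence carry no mass. The
  -- closed range `x ≤ Z t` matters: it includes the interface itself.
  have key : ∀ t ∈ Ioo 0 T, ∀ x ≤ Z t, u t x = 0 ∧ ux t x = 0 := by
    intro t ht
    have htI : t ∈ Icc 0 T := ⟨ht.1.le, ht.2.le⟩
    refine h.velocity_eq_zero_of_vacuum hν hγ ht fun x hx => ?_
    obtain ⟨W, hW, rfl⟩ := h.exists_trajectory hT htI x
    have := h.trajectory_lt hT hW hZ htI h0T hx
    exact h.density_eq_zero hT hW h0T htI (hvac _ (by rwa [hZ0] at this))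
  have hZc : ∀ t ∈ Icc 0 T, Z t = 0 := by
    intro t ht
    rw [← hZ0]
    have hd : ∀ s ∈ Ioo 0 T, HasDerivAt Z 0 s := fun s hs => by
      have := hZ.hasDerivAt s hs
      rwa [(key s hs _ le_rfl).1] at this
    have := abs_le_exp_mul_abs (K := 0) (d := fun s => Z s - Z 0) (d' := fun _ => 0) le_rfl
      (hZ.continuousOn.sub continuousOn_const) (fun s hs => (hd s hs).sub_const _)
      (fun s _ => by simp) ht h0T
    simpa [sub_eq_zero] using this
  refine ⟨fun t ht => ?_, Z, hZ, hZc⟩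
  have := key t ht (Z t) le_rfl
  rwa [hZc t ⟨ht.1.le, ht.2.le⟩] at this

/-- A lower bound on the logarithmic derivative of the initial density near the left interface
keeps the density increasing there for a short time. -/
lemma density_monotoneOn (h : IsStrongSolution ν A γ T M ρ u ux) (hν : 0 < ν) (hγ : 1 < γ)
    (hT : 0 < T) (hvac : ∀ x < 0, ρ 0 x = 0) {b l₁ l₃ t : ℝ}
    (hpos : ∀ x ∈ Ioo 0 l₃, 0 < ρ 0 x) (hl₁ : 0 < l₁)
    (hlog : ∀ x ∈ Ioo 0 l₃, l₁ ≤ deriv (ρ 0) x / ρ 0 x) (ht : t ∈ Ioo 0 T)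
    (hbt : b + M * t ≤ l₃) (hlt : M * Real.exp (M * T) * t ≤ l₁) :
    (∀ x ∈ Ioo 0 b, 0 < ρ t x) ∧ MonotoneOn (ρ t) (Ioo 0 b) := by
  have h0T : (0 : ℝ) ∈ Icc 0 T := ⟨le_rfl, hT.le⟩
  have htI : t ∈ Icc 0 T := ⟨ht.1.le, ht.2.le⟩
  have hM := h.nonneg_bound hT
  obtain ⟨-, Z, hZ, hZ0⟩ := h.interface_stationary hν hγ hT hvac
  -- The stationary interface bounds the starting point on the left; the speed bound `M` and `b + M
  -- * t ≤ l₃` bound it on the right.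
  have hback : ∀ W, IsTrajectory T u W → W t ∈ Ioo 0 b → W 0 ∈ Ioo 0 l₃ := by
    intro W hW hWt
    constructor
    · have := h.trajectory_lt hT hZ hW htI h0T (by rw [hZ0 t htI]; exact hWt.1)
      rwa [hZ0 0 h0T] at this
    · have := neg_abs_le (W t - W 0)
      linarith [h.trajectory_sub_initial_le hW ht, hWt.2]
  refine ⟨fun x hx => ?_, fun x hx y hy hxy => ?_⟩
  · obtain ⟨W, hW, rfl⟩ := h.exists_trajectory hT htI x
    exact h.density_pos hT hW h0T htI (hpos _ (hback W hW hx))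
  rcases hxy.eq_or_lt with rfl | hxy
  · rfl
  obtain ⟨X, hX, rfl⟩ := h.exists_trajectory hT htI x
  obtain ⟨Y, hY, rfl⟩ := h.exists_trajectory hT htI y
  have hX0 := hback X hX hx
  have hY0 := hback Y hY hy
  have hXY : X 0 < Y 0 := h.trajectory_lt hT hX hY htI h0T hxy
  have hXpos : ∀ s ∈ Icc 0 T, 0 < ρ s (X s) := fun s hs => h.density_pos hT hX h0T hs (hpos _ hX0)
  have hYpos : ∀ s ∈ Icc 0 T, 0 < ρ s (Y s) := fun s hs => h.density_pos hT hY h0T hs (hpos _ hY0)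
  have hstart : l₁ * (Y 0 - X 0) ≤ Real.log (ρ 0 (Y 0)) - Real.log (ρ 0 (X 0)) := by
    have hd : ∀ z ∈ Ioo 0 l₃,
        HasDerivAt (fun z => Real.log (ρ 0 z)) (deriv (ρ 0) z / ρ 0 z) z := by
      intro z hz
      refine HasDerivAt.log ?_ (hpos z hz).ne'
      -- Differentiability is not assumed: at a bad point `deriv` would be `0`, against the positive
      -- lower bound `l₁`.
      refine (differentiableAt_of_deriv_ne_zero fun e => ?_).hasDerivAt
      have := hlog z hz
      rw [e, zero_div] at this
      linarith
    obtain ⟨c, hc, hc'⟩ := exists_hasDerivAt_eq_slope (fun z => Real.log (ρ 0 z))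
      (fun z => deriv (ρ 0) z / ρ 0 z) hXY
      (fun z hz => (hd z ⟨hX0.1.trans_le hz.1, hz.2.trans_lt hY0.2⟩).continuousAt.continuousWithinAt)
      (fun z hz => hd z ⟨hX0.1.trans hz.1, hz.2.trans hY0.2⟩)
    have := hlog c ⟨hX0.1.trans hc.1, hc.2.trans hY0.2⟩
    rwa [hc', le_div_iff₀ (sub_pos.2 hXY)] at this
  have hd : ∀ s ∈ Ioo 0 T, HasDerivAt (fun s => Real.log (ρ s (Y s)) - Real.log (ρ s (X s)))
      (ux s (X s) - ux s (Y s)) s := by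
    intro s hs
    have hsI : s ∈ Icc 0 T := ⟨hs.1.le, hs.2.le⟩
    have h1 := (h.transport Y s hs (hY.hasDerivAt s hs)).log (hYpos s hsI).ne'
    have h2 := (h.transport X s hs (hX.hasDerivAt s hs)).log (hXpos s hsI).ne'
    convert! h1.sub h2 using 1
    have e1 := (hYpos s hsI).ne'
    have e2 := (hXpos s hsI).ne'
    field_simp
    ring
  have hc : ContinuousOn (fun s => Real.log (ρ s (Y s)) - Real.log (ρ s (X s))) (Icc 0 T) :=
    ((h.continuousOn_comp_trajectory hY).log fun s hs => (hYpos s hs).ne').sub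
      ((h.continuousOn_comp_trajectory hX).log fun s hs => (hXpos s hs).ne')
  obtain ⟨c, hcm, hc'⟩ := exists_hasDerivAt_eq_slope _ (fun s => ux s (X s) - ux s (Y s)) ht.1
    (hc.mono (Icc_subset_Icc le_rfl ht.2.le)) (fun s hs => hd s ⟨hs.1, hs.2.trans ht.2⟩)
  have hcT : c ∈ Ioo 0 T := ⟨hcm.1, hcm.2.trans ht.2⟩
  have h1 := h.gradient_lipschitz c hcT (X c) (Y c)
  have h2 := h.trajectory_sub_le hT hX hY (s := c) (r := 0) ⟨hcT.1.le, hcT.2.le⟩ h0T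
  rw [abs_of_pos (sub_pos.2 hXY)] at h2
  rw [abs_sub_comm (X c)] at h1
  -- The logarithmic gap starts at no less than `l₁ (Y 0 - X 0)` and loses at most `M exp (M T) t (Y
  -- 0 - X 0)` by time `t`, which `hlt` keeps below the start.
  have h3 : -(M * (Real.exp (M * T) * (Y 0 - X 0))) ≤ ux c (X c) - ux c (Y c) := by
    have := neg_abs_le (ux c (X c) - ux c (Y c))
    have := mul_le_mul_of_nonneg_left h2 hM
    linarith
  rw [hc', sub_zero, le_div_iff₀ ht.1] at h3
  have h4 := mul_le_mul_of_nonneg_right hlt (sub_pos.2 hXY).le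
  have h5 : Real.log (ρ t (X t)) ≤ Real.log (ρ t (Y t)) := by nlinarith
  exact (Real.log_le_log_iff (hXpos t htI) (hYpos t htI)).1 h5

/-- Comparison with the barrier `-ε (exp (k (x - s(t))) - 1)`, `s(t) = σ₀ - σ₁ t`, to the right of
the line `x = s(t)`. -/
lemma le_barrier (h : IsStrongSolution ν A γ T M ρ u ux) (hν : 0 < ν) (hA : 0 < A) (hγ : 1 < γ)
    {b t₁ ε k σ₀ σ₁ : ℝ} (ht₁ : t₁ ∈ Ioo 0 T)
    (hρ : ∀ t ∈ Ioc 0 t₁, ∀ x ∈ Ioo 0 b, 0 < ρ t x)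
    (hmono : ∀ t ∈ Ioc 0 t₁, MonotoneOn (ρ t) (Ioo 0 b)) (hε : 0 ≤ ε) (hk : 0 ≤ k)
    (hσ : ∀ t ∈ Icc 0 t₁, 0 ≤ σ₀ - σ₁ * t)
    (hkν : ∀ t ∈ Ioc 0 t₁, ∀ x ∈ Ioo 0 b, ρ t x * (σ₁ + u t x) ≤ ν * k)
    (hstart : ∀ x ∈ Icc σ₀ b, u 0 x ≤ -(ε * (Real.exp (k * (x - σ₀)) - 1)))
    (hside : ∀ t ∈ Icc 0 t₁, σ₀ - σ₁ * t ≤ b → u t (σ₀ - σ₁ * t) ≤ 0)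
    (hright : ∀ t ∈ Icc 0 t₁, u t b ≤ -(ε * (Real.exp (k * (b - (σ₀ - σ₁ * t))) - 1))) :
    ∀ t ∈ Icc 0 t₁, ∀ x ∈ Icc (σ₀ - σ₁ * t) b,
      u t x ≤ -(ε * (Real.exp (k * (x - (σ₀ - σ₁ * t))) - 1)) := by
  intro t₀ ht₀ x₀ hx₀
  let K : Set (ℝ × ℝ) := {q | q ∈ Icc 0 t₁ ×ˢ Icc 0 b ∧ σ₀ - σ₁ * q.1 ≤ q.2}
  have hK : IsCompact K := by
    refine (isCompact_Icc.prod isCompact_Icc).inter_right ?_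
    exact isClosed_le (f := fun q : ℝ × ℝ => σ₀ - σ₁ * q.1) (g := fun q => q.2) (by fun_prop)
      (by fun_prop)
  have hKn : K.Nonempty := ⟨(t₀, x₀), ⟨ht₀, (hσ t₀ ht₀).trans hx₀.1, hx₀.2⟩, hx₀.1⟩
  -- The penalty `η t` makes the inequality at an interior maximum strict; `η → 0` at the end.
  have hw : ∀ η > 0, u t₀ x₀ + ε * (Real.exp (k * (x₀ - (σ₀ - σ₁ * t₀))) - 1) - η * t₀ ≤ 0 := by
    intro η hη
    let w : ℝ × ℝ → ℝ := fun q =>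
      u q.1 q.2 + ε * (Real.exp (k * (q.2 - (σ₀ - σ₁ * q.1))) - 1) - η * q.1
    have hwc : ContinuousOn w K := by
      have : ContinuousOn (fun q : ℝ × ℝ => u q.1 q.2) K :=
        h.continuousOn_velocity.mono fun q hq =>
          ⟨⟨hq.1.1.1, hq.1.1.2.trans ht₁.2.le⟩, mem_univ _⟩
      exact (this.add (by fun_prop)).sub (by fun_prop)
    obtain ⟨⟨t, x⟩, hq, hmax⟩ := hK.exists_isMaxOn hKn hwc
    have hle : w (t₀, x₀) ≤ w (t, x) := hmax ⟨⟨ht₀, (hσ t₀ ht₀).trans hx₀.1, hx₀.2⟩, hx₀.1⟩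
    refine hle.trans ?_
    obtain ⟨⟨ht, hx⟩, hsx⟩ := hq
    simp only at ht hx hsx
    show u t x + ε * (Real.exp (k * (x - (σ₀ - σ₁ * t))) - 1) - η * t ≤ 0
    have hηt : 0 ≤ η * t := mul_nonneg hη.le ht.1
    rcases ht.1.eq_or_lt with ht0 | ht0
    · subst ht0
      have := hstart x ⟨by linarith, hx.2⟩
      simp only [mul_zero, sub_zero] at *
      linarith
    rcases hsx.eq_or_lt with hsx' | hsx'
    · have := hside t ht (by rw [hsx']; exact hx.2)
      rw [← hsx']
      simp only [sub_self, mul_zero, Real.exp_zero]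
      linarith
    rcases hx.2.eq_or_lt with hxb | hxb
    · have := hright t ht
      rw [hxb]; linarith
    -- The maximum lies off the initial time and the lateral sides. It may lie at `t = t₁`, so only
    -- a one-sided comparison in time is used.
    exfalso
    have hx0 : 0 < x := (hσ t ht).trans_lt hsx'
    have htT : t ∈ Ioo 0 T := ⟨ht0, ht.2.trans_lt ht₁.2⟩
    have htI : t ∈ Icc 0 T := ⟨htT.1.le, htT.2.le⟩
    have hxI : x ∈ Ioo 0 b := ⟨hx0, hxb⟩
    obtain ⟨ρx, ut, uxx, hρx, hut, huxx, heq⟩ := h.momentum t htT x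
    set E := Real.exp (k * (x - (σ₀ - σ₁ * t))) with hE
    have hEpos : 0 < E := Real.exp_pos _
    have htime : 0 ≤ ut + ε * (E * (k * σ₁)) - η := by
      have hd : HasDerivAt (fun s => w (s, x)) (ut + ε * (E * (k * σ₁)) - η) t := by
        have h1 : HasDerivAt (fun s : ℝ => k * (x - (σ₀ - σ₁ * s))) (k * σ₁) t := by
          have := (((hasDerivAt_id t).const_mul σ₁).const_sub σ₀).const_sub x |>.const_mul k
          simpa using this
        have h2 := (hut.add ((h1.exp.sub_const 1).const_mul ε)).sub
          ((hasDerivAt_id t).const_mul η)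
        convert! h2 using 1
        simp [hE]
      refine deriv_nonneg_of_eventually_le hd ?_
      have hev : ∀ᶠ s in 𝓝 t, σ₀ - σ₁ * s < x :=
        (by fun_prop : Continuous fun s => σ₀ - σ₁ * s).continuousAt.eventually_lt
          continuousAt_const hsx'
      filter_upwards [hev.filter_mono nhdsWithin_le_nhds, self_mem_nhdsWithin,
        (lt_mem_nhds ht0).filter_mono nhdsWithin_le_nhds] with s hs1 hs2 hs3
      have hs2 : s < t := hs2
      exact hmax ⟨⟨⟨hs3.le, hs2.le.trans ht.2⟩, hx⟩, hs1.le⟩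
    have hexp : ∀ y, HasDerivAt (fun y => Real.exp (k * (y - (σ₀ - σ₁ * t))))
        (Real.exp (k * (y - (σ₀ - σ₁ * t))) * k) y := by
      intro y
      have := ((hasDerivAt_id y).sub_const (σ₀ - σ₁ * t)).const_mul k |>.exp
      simpa using this
    have hd1 : ∀ y, HasDerivAt (fun y => w (t, y))
        (ux t y + ε * (Real.exp (k * (y - (σ₀ - σ₁ * t))) * k)) y := fun y =>
      ((h.hasDerivAt_velocity t htI y).add (((hexp y).sub_const 1).const_mul ε)).sub_const (η * t)
    have hd2 : HasDerivAt (fun y => ux t y + ε * (Real.exp (k * (y - (σ₀ - σ₁ * t))) * k))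
        (uxx + ε * (E * k * k)) x := huxx.add (((hexp x).mul_const k).const_mul ε)
    have hloc : IsLocalMax (fun y => w (t, y)) x := by
      filter_upwards [Ioo_mem_nhds hsx' hxb] with y hy
      exact hmax ⟨⟨ht, (hσ t ht).trans hy.1.le, hy.2.le⟩, hy.1.le⟩
    have hfirst := hloc.hasDerivAt_eq_zero (hd1 x)
    rw [← hE] at hfirst
    have hsecond := second_deriv_nonpos_of_isLocalMax hd1 hd2 hloc
    have hρpos := hρ t ⟨ht0, ht.2⟩ x hxI
    have hρx0 : 0 ≤ ρx := by
      refine hρx.hasDerivWithinAt.nonneg_of_monotoneOn ?_ (hmono t ⟨ht0, ht.2⟩)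
      exact accPt_principal_iff_nhdsWithin.2 (by
        have : Ioo 0 b \ {x} ∈ 𝓝[≠] x := by
          rw [sdiff_eq]
          exact inter_mem (mem_nhdsWithin_of_mem_nhds (Ioo_mem_nhds hxI.1 hxI.2))
            self_mem_nhdsWithin
        have e : 𝓝[Ioo 0 b \ {x}] x = 𝓝[≠] x :=
          le_antisymm (nhdsWithin_mono x fun y hy => hy.2)
            (nhdsWithin_le_of_mem this)
        rw [e]; infer_instance)
    have hpx : 0 ≤ A * γ * ρ t x ^ (γ - 1) * ρx := by
      have : 0 < γ := by linarith
      positivity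
    have hkx := hkν t ⟨ht0, ht.2⟩ x hxI
    have hux : ux t x = -(ε * (E * k)) := by linarith
    rw [hux] at heq
    have h1 := mul_nonneg hρpos.le htime
    have h2 := mul_le_mul_of_nonneg_left hkx (show 0 ≤ ε * (E * k) by positivity)
    have h3 := mul_nonneg hν.le (neg_nonneg.2 hsecond)
    have h4 := mul_pos hρpos hη
    -- At the maximum `u_t ≥ η - ε E k σ₁`, `u_x = -ε E k` and `u_xx ≤ -ε E k²`. With `p_x ≥ 0` and
    -- `ρ (σ₁ + u) ≤ ν k`, the momentum equation forces `ρ η ≤ 0`.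
    nlinarith
  have ht₁0 := ht₁.1
  have : u t₀ x₀ + ε * (Real.exp (k * (x₀ - (σ₀ - σ₁ * t₀))) - 1) ≤ 0 := by
    refine le_of_forall_pos_le_add fun δ hδ => ?_
    have h1 := hw (δ / t₁) (by positivity)
    have h2 : δ / t₁ * t₀ ≤ δ := by
      rw [div_mul_eq_mul_div, div_le_iff₀ ht₁0]
      exact mul_le_mul_of_nonneg_left ht₀.2 hδ.le
    linarith
  linarith

end IsStrongSolution

end IsentropicNS

/-! ### Contradiction at the interface -/

namespace IsentropicNS

namespace IsStrongSolution

variable {ν A γ T M : ℝ} {ρ u ux : ℝ → ℝ → ℝ}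

theorem not_leftCondition (h : IsStrongSolution ν A γ T M ρ u ux) (hν : 0 < ν) (hA : 0 < A)
    (hγ : 1 < γ) (hT : 0 < T) (hvac : ∀ x < 0, ρ 0 x = 0) (hpos : ∀ x ∈ Ioo 0 1, 0 < ρ 0 x) :
    ¬ LeftCondition (ρ 0) (u 0) := by
  rintro ⟨l₁, l₃, hl₁, hl₃, hl₃1, hlog, hul₃, hu0⟩
  have h0T : (0 : ℝ) ∈ Icc 0 T := ⟨le_rfl, hT.le⟩
  have hM := h.nonneg_bound hT
  have hu0c : Continuous (u 0) :=
    continuous_iff_continuousAt.2 fun x => (h.hasDerivAt_velocity 0 h0T x).continuousAt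
  -- Moving from `l₃` to a slightly smaller `b` keeps `u₀ < 0` and leaves room for trajectories to
  -- drift for a short time.
  obtain ⟨b, hub, hbl₃, hb⟩ : ∃ b, u 0 b < 0 ∧ b < l₃ ∧ 0 < b := by
    have h1 : ∀ᶠ b in 𝓝[<] l₃, u 0 b < 0 :=
      (hu0c.continuousAt.eventually_lt continuousAt_const hul₃).filter_mono nhdsWithin_le_nhds
    have h2 : ∀ᶠ b in 𝓝[<] l₃, 0 < b := (lt_mem_nhds hl₃).filter_mono nhdsWithin_le_nhds
    obtain ⟨b, hb1, hb2, hb3⟩ := (h1.and (h2.and self_mem_nhdsWithin)).exists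
    exact ⟨b, hb1, hb3, hb2⟩
  obtain ⟨δ, hδ, hδb⟩ : ∃ δ > 0, u 0 b < -δ := ⟨-u 0 b / 2, by linarith, by linarith⟩
  obtain ⟨τ, hτ, hτb⟩ : ∃ τ > 0, ∀ t ∈ Icc 0 T, t < τ → u t b < -δ := by
    have hc : ContinuousWithinAt (fun t => u t b) (Icc 0 T) 0 :=
      (h.continuousOn_velocity.comp (f := fun s => (s, b)) (by fun_prop)
        (fun s hs => ⟨hs, mem_univ _⟩)) 0 h0T
    obtain ⟨τ, hτ, hτb⟩ := Metric.mem_nhdsWithin_iff.1 (hc.eventually_lt continuousWithinAt_const hδb)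
    refine ⟨τ, hτ, fun t ht htτ => hτb ⟨?_, ht⟩⟩
    rw [Metric.mem_ball, Real.dist_eq, sub_zero, abs_of_nonneg ht.1]
    exact htτ
  obtain ⟨t₁, ht₁0, ht₁τ, ht₁T, ht₁b, ht₁l⟩ : ∃ t₁ > 0, t₁ < τ ∧ t₁ < T ∧ b + M * t₁ ≤ l₃ ∧
      M * Real.exp (M * T) * t₁ ≤ l₁ := by
    have h1 : ∀ᶠ t in 𝓝 (0 : ℝ), t < τ := gt_mem_nhds hτ
    have h2 : ∀ᶠ t in 𝓝 (0 : ℝ), t < T := gt_mem_nhds hT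
    have h3 : ∀ᶠ t in 𝓝 (0 : ℝ), b + M * t < l₃ :=
      (by fun_prop : Continuous fun t => b + M * t).continuousAt.eventually_lt
        continuousAt_const (by simpa using hbl₃)
    have h4 : ∀ᶠ t in 𝓝 (0 : ℝ), M * Real.exp (M * T) * t < l₁ :=
      (by fun_prop : Continuous fun t => M * Real.exp (M * T) * t).continuousAt.eventually_lt
        continuousAt_const (by simpa using hl₁)
    obtain ⟨t, ht, ht0⟩ := (((h1.and (h2.and (h3.and h4))).filter_mono
      (nhdsWithin_le_nhds (s := Ioi 0))).and self_mem_nhdsWithin).exists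
    exact ⟨t, ht0, ht.1, ht.2.1, ht.2.2.1.le, ht.2.2.2.le⟩
  obtain ⟨hinteg, -⟩ := h.interface_stationary hν hγ hT hvac
  have hdens : ∀ t ∈ Ioc 0 t₁, (∀ x ∈ Ioo 0 b, 0 < ρ t x) ∧ MonotoneOn (ρ t) (Ioo 0 b) := by
    intro t ht
    refine h.density_monotoneOn hν hγ hT hvac
      (fun x hx => hpos x ⟨hx.1, hx.2.trans hl₃1⟩) hl₁ hlog ⟨ht.1, ht.2.trans_lt ht₁T⟩ ?_ ?_
    · have := mul_le_mul_of_nonneg_left ht.2 hM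
      linarith
    · have := mul_le_mul_of_nonneg_left ht.2 (show 0 ≤ M * Real.exp (M * T) by positivity)
      linarith
  obtain ⟨R, hR⟩ := (isCompact_Icc.prod isCompact_Icc).exists_bound_of_continuousOn
    (h.continuousOn_density.mono (prod_mono (Icc_subset_Icc le_rfl ht₁T.le) (subset_univ (Icc 0 b))))
  have hR' : ∀ t ∈ Icc 0 t₁, ∀ x ∈ Icc 0 b, ρ t x ≤ R := fun t ht x hx =>
    (le_abs_self _).trans (hR (t, x) ⟨ht, hx⟩)
  have hR0 : 0 ≤ R := (norm_nonneg _).trans (hR (0, 0) ⟨⟨le_rfl, ht₁0.le⟩, ⟨le_rfl, hb.le⟩⟩)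
  -- One `k` serves both uses of the barrier, with line speeds `0` and `b / t₁`.
  obtain ⟨k, hk, hkν⟩ : ∃ k > 0, R * (b / t₁ + M) ≤ ν * k := by
    refine ⟨R * (b / t₁ + M) / ν + 1, by positivity, ?_⟩
    rw [mul_add ν, mul_div_cancel₀ _ hν.ne']
    linarith
  have hkν' : ∀ σ, 0 ≤ σ → σ ≤ b / t₁ → ∀ t ∈ Ioc 0 t₁, ∀ x ∈ Ioo 0 b,
      ρ t x * (σ + u t x) ≤ ν * k := by
    intro σ hσ hσ' t ht x hx
    refine le_trans ?_ hkν
    have h1 := hR' t ⟨ht.1.le, ht.2⟩ x ⟨hx.1.le, hx.2.le⟩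
    have h2 := (hdens t ht).1 x hx
    have h3 := (le_abs_self _).trans (h.velocity_le t ⟨ht.1.le, ht.2.trans ht₁T.le⟩ x)
    calc ρ t x * (σ + u t x) ≤ ρ t x * (b / t₁ + M) :=
          mul_le_mul_of_nonneg_left (by linarith) h2.le
      _ ≤ R * (b / t₁ + M) := mul_le_mul_of_nonneg_right h1 (by positivity)
  have hright : ∀ t ∈ Icc 0 t₁, u t b ≤ -δ := fun t ht =>
    (hτb t ⟨ht.1, ht.2.trans ht₁T.le⟩ (ht.2.trans_lt ht₁τ)).le
  have hu0' : ∀ x ∈ Icc 0 b, u 0 x ≤ 0 := by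
    have : closure (Ioo 0 l₃) ⊆ {x | u 0 x ≤ 0} :=
      closure_minimal hu0 (isClosed_le hu0c continuous_const)
    rw [closure_Ioo hl₃.ne] at this
    exact fun x hx => this ⟨hx.1, hx.2.trans hbl₃.le⟩
  -- With `ε = 0` and the fixed line `x = 0`, the comparison is the weak maximum principle.
  have hnonpos : ∀ t ∈ Icc 0 t₁, ∀ x ∈ Icc 0 b, u t x ≤ 0 := by
    have := h.le_barrier hν hA hγ (b := b) (ε := 0) (k := k) (σ₀ := 0) (σ₁ := 0) ⟨ht₁0, ht₁T⟩
      (fun t ht => (hdens t ht).1) (fun t ht => (hdens t ht).2) le_rfl hk.le (by simp)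
      (hkν' 0 le_rfl (by positivity)) (by simpa using hu0') ?_ ?_
    · simpa using this
    · intro t ht _
      simp only [zero_mul, sub_zero]
      rcases ht.1.eq_or_lt with rfl | h0
      · exact hu0' 0 ⟨le_rfl, hb.le⟩
      · exact (hinteg t ⟨h0, ht.2.trans_lt ht₁T⟩).1.le
    · intro t ht
      simp only [zero_mul, neg_zero]
      linarith [hright t ht]
  obtain ⟨ε, hε, hεδ⟩ : ∃ ε > 0, ε * Real.exp (k * b) = δ :=
    ⟨δ / Real.exp (k * b), by positivity, div_mul_cancel₀ _ (Real.exp_pos _).ne'⟩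
  have hs : ∀ t ∈ Icc 0 t₁, 0 ≤ b - b / t₁ * t := by
    intro t ht
    have : b / t₁ * t ≤ b / t₁ * t₁ := mul_le_mul_of_nonneg_left ht.2 (by positivity)
    rw [div_mul_cancel₀ _ ht₁0.ne'] at this
    linarith
  have hbarrier : ∀ t ∈ Icc 0 t₁, u t b ≤ -(ε * (Real.exp (k * (b - (b - b / t₁ * t))) - 1)) := by
    intro t ht
    have h1 : Real.exp (k * (b - (b - b / t₁ * t))) ≤ Real.exp (k * b) :=
      Real.exp_le_exp.2 (mul_le_mul_of_nonneg_left (by linarith [hs t ht]) hk.le)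
    have h2 := mul_le_mul_of_nonneg_left h1 hε.le
    linarith [hright t ht]
  -- The line runs from `x = b` at time `0` to the interface at time `t₁`. The initial slice is the
  -- single point `b`, so `u₀ ≤ 0` suffices there.
  have hfinal := h.le_barrier hν hA hγ (b := b) (ε := ε) (k := k) (σ₀ := b) (σ₁ := b / t₁)
    ⟨ht₁0, ht₁T⟩ (fun t ht => (hdens t ht).1) (fun t ht => (hdens t ht).2) hε.le hk.le hs
    (hkν' _ (by positivity) le_rfl)
    (fun x hx => by
      obtain rfl : x = b := le_antisymm hx.2 hx.1
      simpa using hu0' x ⟨hb.le, le_rfl⟩)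
    (fun t ht hle => hnonpos t ht _ ⟨hs t ht, hle⟩) hbarrier t₁ ⟨ht₁0.le, le_rfl⟩
  rw [div_mul_cancel₀ _ ht₁0.ne', sub_self] at hfinal
  obtain ⟨hz, hzx⟩ := hinteg t₁ ⟨ht₁0, ht₁T⟩
  -- This function is at most its value `0` at the interface for small `x > 0`, yet its slope there
  -- is `ε k > 0` because `u_x = 0`.
  have hd : HasDerivAt (fun x => u t₁ x + ε * (Real.exp (k * x) - 1)) (ε * k) 0 := by
    have h1 := h.hasDerivAt_velocity t₁ ⟨ht₁0.le, ht₁T.le⟩ 0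
    have h2 : HasDerivAt (fun x : ℝ => Real.exp (k * x)) (Real.exp (k * 0) * (k * 1)) 0 :=
      ((hasDerivAt_id (0 : ℝ)).const_mul k).exp
    have h3 := h1.add ((h2.sub_const 1).const_mul ε)
    convert! h3 using 1
    simp [hzx]
  have := deriv_nonpos_of_eventually_le hd (by
    filter_upwards [Ioo_mem_nhdsGT hb] with x hx
    have := hfinal x ⟨hx.1.le, hx.2.le⟩
    simp only [sub_zero] at this
    simp only [hz, mul_zero, Real.exp_zero]
    linarith)
  nlinarith [mul_pos hε hk]

/-- The equations are invariant under the reflection `x ↦ 1 - x`, `u ↦ -u`. -/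
lemma reflect (h : IsStrongSolution ν A γ T M ρ u ux) :
    IsStrongSolution ν A γ T M (fun t x => ρ t (1 - x)) (fun t x => -u t (1 - x))
      (fun t x => ux t (1 - x)) := by
  have hneg : ∀ x : ℝ, HasDerivAt (fun y : ℝ => 1 - y) (-1) x := fun x =>
    (hasDerivAt_id x).const_sub 1
  refine ⟨⟨?_, ?_, ?_, ?_, ?_, ?_⟩, ?_, ?_, ?_⟩
  · exact h.continuousOn_density.comp (f := fun q : ℝ × ℝ => (q.1, 1 - q.2)) (by fun_prop)
      (fun q hq => ⟨hq.1, mem_univ _⟩)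
  · exact (h.continuousOn_velocity.comp (f := fun q : ℝ × ℝ => (q.1, 1 - q.2)) (by fun_prop)
      (fun q hq => ⟨hq.1, mem_univ _⟩)).neg
  · intro t ht x; rw [abs_neg]; exact h.velocity_le t ht _
  · intro t ht x; exact h.gradient_le t ht _
  · intro t ht x
    have := ((h.hasDerivAt_velocity t ht (1 - x)).comp x (hneg x)).neg
    convert! this using 1
    ring
  · intro Z t ht hZ
    have h1 : HasDerivAt (fun s => 1 - Z s) (u t (1 - Z t)) t := by simpa using hZ.const_sub 1
    exact h.transport (fun s => 1 - Z s) t ht h1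
  · intro t ht
    have h1 : Tendsto (fun x : ℝ => 1 - x) (cocompact ℝ) (cocompact ℝ) :=
      (Homeomorph.subLeft (1 : ℝ)).isClosedEmbedding.tendsto_cocompact
    simpa using ((h.tendsto_velocity t ht).comp h1).neg
  · intro t ht x y
    refine (h.gradient_lipschitz t ht _ _).trans_eq ?_
    rw [show 1 - x - (1 - y) = -(x - y) by ring, abs_neg]
  · intro t ht x
    obtain ⟨ρx, ut, uxx, h1, h2, h3, h4⟩ := h.momentum t ht (1 - x)
    refine ⟨-ρx, -ut, -uxx, ?_, h2.neg, ?_, by linarith⟩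
    · simpa using! h1.comp x (hneg x)
    · simpa using! h3.comp x (hneg x)

theorem not_rightCondition (h : IsStrongSolution ν A γ T M ρ u ux) (hν : 0 < ν) (hA : 0 < A)
    (hγ : 1 < γ) (hT : 0 < T) (hvac : ∀ x, 1 < x → ρ 0 x = 0) (hpos : ∀ x ∈ Ioo 0 1, 0 < ρ 0 x) :
    ¬ RightCondition (ρ 0) (u 0) := by
  rintro ⟨l₂, l₄, hl₂, hl₄, hl₄1, hlog, hul₄, hu0⟩
  refine h.reflect.not_leftCondition hν hA hγ hT (fun x hx => hvac _ (by linarith))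
    (fun x hx => hpos _ ⟨by linarith [hx.2], by linarith [hx.1]⟩)
    ⟨l₂, 1 - l₄, hl₂, by linarith, by linarith, fun x hx => ?_, ?_, fun x hx => ?_⟩
  · have := hlog (1 - x) ⟨by linarith [hx.2], by linarith [hx.1]⟩
    rw [deriv_comp_const_sub, neg_div]
    linarith
  · simpa using hul₄
  · simpa using hu0 (1 - x) ⟨by linarith [hx.2], by linarith [hx.1]⟩

end IsStrongSolution

end IsentropicNS

/-! ### Weak derivatives, and curves of bounded continuous functions -/

namespace IsentropicNS

section TestFunctions

lemma integral_mul_deriv_eq_neg {f f' φ : ℝ → ℝ} (hf : ∀ x, HasDerivAt f (f' x) x)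
    (hf' : Continuous f') (hφ : ContDiff ℝ ∞ φ) (hφc : HasCompactSupport φ) :
    ∫ x, f x * deriv φ x = -∫ x, f' x * φ x := by
  have hfc : Continuous f := continuous_iff_continuousAt.2 fun x => (hf x).continuousAt
  have hdc : Continuous (deriv φ) := hφ.continuous_deriv (by simp)
  refine integral_mul_deriv_eq_deriv_mul_of_integrable (fun x _ => hf x)
    (fun x _ => ((hφ.differentiable (by simp)) x).hasDerivAt) ?_ ?_ ?_
  · exact (hfc.mul hdc).integrable_of_hasCompactSupport hφc.deriv.mul_left
  · exact (hf'.mul hφ.continuous).integrable_of_hasCompactSupport hφc.mul_left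
  · exact (hfc.mul hφ.continuous).integrable_of_hasCompactSupport hφc.mul_left

lemma eq_of_integral_test_eq {f g : ℝ → ℝ} (hf : Continuous f) (hg : Continuous g)
    (h : ∀ φ : ℝ → ℝ, ContDiff ℝ ∞ φ → HasCompactSupport φ →
      ∫ x, f x * φ x = ∫ x, g x * φ x) : f = g := by
  refine (Continuous.ae_eq_iff_eq volume hf hg).1 ?_
  refine ae_eq_of_integral_contDiff_smul_eq hf.locallyIntegrable hg.locallyIntegrable
    fun φ hφ hφc => ?_
  simpa [mul_comm] using h φ hφ hφc

/-- A compactly supported smooth function with vanishing integral is the derivative of a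
compactly supported smooth function. -/
lemma exists_deriv_eq_of_integral_eq_zero {ψ : ℝ → ℝ} (hψ : ContDiff ℝ ∞ ψ)
    (hψc : HasCompactSupport ψ) (h0 : ∫ x, ψ x = 0) :
    ∃ φ : ℝ → ℝ, ContDiff ℝ ∞ φ ∧ HasCompactSupport φ ∧ deriv φ = ψ := by
  obtain ⟨r, hr⟩ := hψc.isCompact.isBounded.subset_ball 0
  have hz : ∀ x, x ∉ Ioo (-r) r → ψ x = 0 := by
    intro x hx
    refine image_eq_zero_of_notMem_tsupport fun h => hx ?_
    have := hr h
    rwa [Metric.mem_ball, Real.dist_eq, sub_zero, abs_lt] at this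
  have hd : ∀ x, HasDerivAt (fun x => ∫ y in (-r)..x, ψ y) (ψ x) x := fun x =>
    intervalIntegral.integral_hasDerivAt_right (hψ.continuous.intervalIntegrable _ _)
      (hψ.continuous.stronglyMeasurableAtFilter _ _) hψ.continuous.continuousAt
  have hde : deriv (fun x => ∫ y in (-r)..x, ψ y) = ψ := funext fun x => (hd x).deriv
  refine ⟨fun x => ∫ y in (-r)..x, ψ y, ?_, ?_, hde⟩
  · rw [contDiff_infty_iff_deriv, hde]
    exact ⟨fun x => (hd x).differentiableAt, hψ⟩
  · refine HasCompactSupport.intro (isCompact_Icc (a := -r) (b := r)) fun x hx => ?_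
    rcases lt_or_ge x (-r) with h | h
    · rw [intervalIntegral.integral_symm, intervalIntegral.integral_zero_ae, neg_zero]
      refine Eventually.of_forall fun y hy => hz y fun hy' => ?_
      rw [uIoc_of_le h.le] at hy
      exact absurd hy.2 (not_le.2 hy'.1)
    · have hxr : r < x := by
        by_contra! hxr; exact hx ⟨h, hxr⟩
      rw [intervalIntegral.integral_of_le h, setIntegral_eq_integral_of_forall_compl_eq_zero, h0]
      exact fun y hy => hz y fun hy' => hy ⟨hy'.1, hy'.2.le.trans hxr.le⟩

/-- A continuous function with continuous weak derivative is classically differentiable. -/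
lemma hasDerivAt_of_weak_deriv {v w : ℝ → ℝ} (hv : Continuous v) (hw : Continuous w)
    (h : ∀ φ : ℝ → ℝ, ContDiff ℝ ∞ φ → HasCompactSupport φ →
      ∫ x, w x * φ x = -∫ x, v x * deriv φ x) (x : ℝ) : HasDerivAt v (w x) x := by
  let V : ℝ → ℝ := fun x => ∫ y in (0 : ℝ)..x, w y
  have hV : ∀ x, HasDerivAt V (w x) x := fun x =>
    intervalIntegral.integral_hasDerivAt_right (hw.intervalIntegrable _ _)
      (hw.stronglyMeasurableAtFilter _ _) hw.continuousAt
  have hVc : Continuous V := continuous_iff_continuousAt.2 fun x => (hV x).continuousAt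
  have hf : Continuous (fun x => v x - V x) := hv.sub hVc
  have hinteg : ∀ {f φ : ℝ → ℝ}, Continuous f → Continuous φ → HasCompactSupport φ →
      Integrable (fun x => f x * φ x) := fun hf hφ hφc =>
    (hf.mul hφ).integrable_of_hasCompactSupport hφc.mul_left
  have hzero : ∀ φ : ℝ → ℝ, ContDiff ℝ ∞ φ → HasCompactSupport φ →
      ∫ x, (v x - V x) * deriv φ x = 0 := by
    intro φ hφ hφc
    have hdc : Continuous (deriv φ) := hφ.continuous_deriv (by simp)
    simp_rw [sub_mul]
    rw [integral_sub (hinteg hv hdc hφc.deriv) (hinteg hVc hdc hφc.deriv),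
      integral_mul_deriv_eq_neg hV hw hφ hφc]
    linarith [h φ hφ hφc]
  let b : ContDiffBump (0 : ℝ) := ⟨1, 2, one_pos, one_lt_two⟩
  let φ₀ : ℝ → ℝ := b.normed volume
  have hφ₀ : ContDiff ℝ ∞ φ₀ := b.contDiff_normed
  have hφ₀c : HasCompactSupport φ₀ := b.hasCompactSupport_normed
  have hφ₀i : ∫ x, φ₀ x = 1 := b.integral_normed
  set C := ∫ x, (v x - V x) * φ₀ x with hC
  -- Subtracting `(∫ ψ) φ₀` from `ψ` leaves mean zero, hence a derivative of a test function,
  -- against which `v - V` integrates to zero.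
  have hconst : (fun x => v x - V x) = fun _ => C := by
    refine eq_of_integral_test_eq hf continuous_const fun ψ hψ hψc => ?_
    have hψi : Integrable ψ := hψ.continuous.integrable_of_hasCompactSupport hψc
    have hφ₀I : Integrable φ₀ := hφ₀.continuous.integrable_of_hasCompactSupport hφ₀c
    have hsm : ContDiff ℝ ∞ (fun x => ψ x - (∫ y, ψ y) * φ₀ x) := hψ.sub (contDiff_const.mul hφ₀)
    obtain ⟨φ, hφ, hφc, hφd⟩ := exists_deriv_eq_of_integral_eq_zero hsm
      (hψc.sub hφ₀c.mul_left) (by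
        rw [integral_sub hψi (hφ₀I.const_mul _), integral_const_mul, hφ₀i]; ring)
    have h1 := hzero φ hφ hφc
    rw [hφd] at h1
    simp_rw [mul_sub, mul_left_comm _ (∫ y, ψ y)] at h1
    rw [integral_sub (hinteg hf hψ.continuous hψc) ((hinteg hf hφ₀.continuous hφ₀c).const_mul _),
      integral_const_mul, ← hC] at h1
    rw [integral_const_mul]
    linarith
  have hve : v = fun x => V x + C := funext fun x => by linarith [congrFun hconst x]
  rw [hve]
  exact (hV x).add_const C

end TestFunctions

section Curves

variable {T : ℝ} {F : ℝ → (ℝ →ᵇ ℝ)}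

lemma hasDerivAt_integral_mul {G : ℝ →ᵇ ℝ} {t : ℝ} (hF : HasDerivAt F G t) {φ : ℝ → ℝ}
    (hφ : Continuous φ) (hφc : HasCompactSupport φ) :
    HasDerivAt (fun s => ∫ x, F s x * φ x) (∫ x, G x * φ x) t := by
  have hinteg : ∀ H : ℝ →ᵇ ℝ, Integrable (fun x => H x * φ x) := fun H =>
    ((map_continuous H).mul hφ).integrable_of_hasCompactSupport hφc.mul_left
  let L : (ℝ →ᵇ ℝ) →ₗ[ℝ] ℝ :=
    { toFun := fun H => ∫ x, H x * φ x
      map_add' := fun H H' => by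
        simp only [BoundedContinuousFunction.add_apply, add_mul]
        exact integral_add (hinteg H) (hinteg H')
      map_smul' := fun c H => by
        simp only [BoundedContinuousFunction.coe_smul, smul_eq_mul, mul_assoc, RingHom.id_apply]
        exact integral_const_mul _ _ }
  let L' : (ℝ →ᵇ ℝ) →L[ℝ] ℝ := L.mkContinuous (∫ x, |φ x|) fun H => by
    refine (norm_integral_le_integral_norm _).trans ?_
    rw [mul_comm, ← integral_const_mul]
    refine integral_mono (hinteg H).norm
      ((hφ.integrable_of_hasCompactSupport hφc).abs.const_mul _) fun x => ?_
    simp only [norm_mul, Real.norm_eq_abs (φ x)]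
    exact mul_le_mul_of_nonneg_right (H.norm_coe_le_norm x) (abs_nonneg _)
  exact L'.hasFDerivAt.comp_hasDerivAt t hF

/-- Split `F s (Z s)` as `(F s - F t) (Z s) + F t (Z s)`; the difference quotients of the first term
converge uniformly in `x`, so a moving evaluation point is harmless. -/
lemma hasDerivAt_eval_curve {G : ℝ →ᵇ ℝ} {Z : ℝ → ℝ} {t z fx : ℝ} (hF : HasDerivAt F G t)
    (hZ : HasDerivAt Z z t) (hx : HasDerivAt (F t) fx (Z t)) :
    HasDerivAt (fun s => F s (Z s)) (G (Z t) + fx * z) t := by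
  have h1 : HasDerivAt (fun s => (F s - F t) (Z s)) (G (Z t)) t := by
    rw [hasDerivAt_iff_tendsto_slope] at hF ⊢
    have h2 : Tendsto (fun s => (slope F t s, Z s)) (𝓝[≠] t) (𝓝 (G, Z t)) :=
      hF.prodMk_nhds (hZ.continuousAt.tendsto.mono_left nhdsWithin_le_nhds)
    refine ((continuous_eval.tendsto _).comp h2).congr fun s => ?_
    simp [slope, vsub_eq_sub]
  have h3 := h1.add (hx.comp t hZ)
  convert! h3 using 1
  ext s
  simp

lemma exists_bound_of_contDiffOn (hF : ContDiffOn ℝ 1 F (Icc 0 T)) (hT : 0 < T) :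
    ∃ (G : ℝ → (ℝ →ᵇ ℝ)) (B : ℝ), (∀ t ∈ Ioo 0 T, HasDerivAt F (G t) t) ∧
      ∀ t ∈ Icc 0 T, (∀ x, |F t x| ≤ B) ∧ ∀ x, |G t x| ≤ B := by
  have hG : ContinuousOn (derivWithin F (Icc 0 T)) (Icc 0 T) :=
    hF.continuousOn_derivWithin (uniqueDiffOn_Icc hT) le_rfl
  obtain ⟨B₁, hB₁⟩ := isCompact_Icc.exists_bound_of_continuousOn hF.continuousOn
  obtain ⟨B₂, hB₂⟩ := isCompact_Icc.exists_bound_of_continuousOn hG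
  refine ⟨derivWithin F (Icc 0 T), max B₁ B₂, fun t ht => ?_, fun t ht => ⟨fun x => ?_, fun x => ?_⟩⟩
  · exact ((hF.differentiableOn (by simp)) t ⟨ht.1.le, ht.2.le⟩).hasDerivWithinAt.hasDerivAt
      (Icc_mem_nhds ht.1 ht.2)
  · exact ((F t).norm_coe_le_norm x).trans ((hB₁ t ht).trans (le_max_left _ _))
  · exact ((derivWithin F (Icc 0 T) t).norm_coe_le_norm x).trans ((hB₂ t ht).trans (le_max_right _ _))

lemma continuousOn_uncurry_curve {s : Set ℝ} (hF : ContinuousOn F s) :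
    ContinuousOn (Function.uncurry fun t x => F t x) (s ×ˢ univ) :=
  continuous_eval.comp_continuousOn
    ((hF.comp continuousOn_fst fun _ hq => hq.1).prodMk continuousOn_snd)

end Curves

end IsentropicNS

/-! ### From distributional to pointwise solutions -/

namespace IsentropicNS

namespace IsSolution

variable {μ lam A γ m T : ℝ} {ρ₀ u₀ : ℝ → ℝ} {ρ u : ℝ → ℝ → ℝ} {R Rx U Ux : ℝ → (ℝ →ᵇ ℝ)}
  {Rt Ut : ℝ →ᵇ ℝ} {t : ℝ}

lemma continuity_pointwise (h : IsSolution μ lam A γ m T ρ₀ u₀ ρ u)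
    (hR : ∀ t ∈ Icc 0 T, ∀ᵐ x, ρ t x = R t x) (hU : ∀ t ∈ Icc 0 T, ∀ᵐ x, u t x = U t x)
    (ht : t ∈ Ioo 0 T) (hRx : ∀ x, HasDerivAt (R t) (Rx t x) x)
    (hUx : ∀ x, HasDerivAt (U t) (Ux t x) x) (hRt : HasDerivAt R Rt t) (x : ℝ) :
    Rt x = -(Rx t x * U t x + R t x * Ux t x) := by
  have htI : t ∈ Icc 0 T := ⟨ht.1.le, ht.2.le⟩
  refine congrFun (eq_of_integral_test_eq (f := Rt)
    (g := fun x => -(Rx t x * U t x + R t x * Ux t x)) (map_continuous Rt) (by fun_prop)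
    fun φ hφ hφc => ?_) x
  have h1 := h.continuity_eq φ hφ hφc t ht
  have h2 : HasDerivAt (fun s => ∫ x, ρ s x * φ x) (∫ x, Rt x * φ x) t := by
    refine (hasDerivAt_integral_mul hRt hφ.continuous hφc).congr_of_eventuallyEq ?_
    filter_upwards [Icc_mem_nhds ht.1 ht.2] with s hs
    refine integral_congr_ae ?_
    filter_upwards [hR s hs] with x hx
    rw [hx]
  have h3 : ∫ x, ρ t x * u t x * deriv φ x = ∫ x, (R t x * U t x) * deriv φ x := by
    refine integral_congr_ae ?_
    filter_upwards [hR t htI, hU t htI] with x hx hx'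
    rw [hx, hx']
  rw [h2.unique h1, h3, integral_mul_deriv_eq_neg (f := fun x => R t x * U t x)
    (fun x => (hRx x).mul (hUx x)) (by fun_prop) hφ hφc, ← integral_neg]
  simp only [neg_mul]

lemma momentum_pointwise (h : IsSolution μ lam A γ m T ρ₀ u₀ ρ u) (hγ : 1 < γ)
    (hν : 0 < μ + (μ + lam))
    (hR : ∀ t ∈ Icc 0 T, ∀ᵐ x, ρ t x = R t x) (hU : ∀ t ∈ Icc 0 T, ∀ᵐ x, u t x = U t x)
    (ht : t ∈ Ioo 0 T) (hRx : ∀ x, HasDerivAt (R t) (Rx t x) x)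
    (hUx : ∀ x, HasDerivAt (U t) (Ux t x) x) (hRt : HasDerivAt R Rt t) (hUt : HasDerivAt U Ut t)
    (x : ℝ) :
    HasDerivAt (Ux t) ((R t x * (Ut x + U t x * Ux t x) + A * γ * R t x ^ (γ - 1) * Rx t x) /
      (μ + (μ + lam))) x := by
  have htI : t ∈ Icc 0 T := ⟨ht.1.le, ht.2.le⟩
  have hcont := h.continuity_pointwise hR hU ht hRx hUx hRt
  set ν := μ + (μ + lam) with hνdef
  let w : ℝ → ℝ := fun x =>
    R t x * (Ut x + U t x * Ux t x) + A * γ * R t x ^ (γ - 1) * Rx t x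
  have hpow : Continuous fun x => R t x ^ (γ - 1) :=
    (map_continuous (R t)).rpow_const fun x => Or.inr (by linarith)
  have hw : Continuous w := by fun_prop
  -- The continuity equation turns `(ρ u)_t + (ρ u²)_x` into `ρ (u_t + u u_x)`, so the flux
  -- derivative is `w - (ρ u)_t`.
  have hflux : ∀ x, HasDerivAt (fun x => R t x * U t x ^ 2 + pressure A γ (R t x))
      (w x - (Rt x * U t x + R t x * Ut x)) x := by
    intro x
    have h1 := (hRx x).mul ((hUx x).pow 2)
    have h2 := ((hRx x).rpow_const (p := γ) (Or.inr hγ.le)).const_mul A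
    convert! h1.add h2 using 1
    simp only [w, hcont x, Pi.pow_apply]
    push_cast
    ring
  -- The second derivative of `u` is not assumed: `w` is continuous and is the weak derivative of `ν
  -- u_x`, hence the classical one.
  have hweak : ∀ x, HasDerivAt (fun x => ν * Ux t x) (w x) x := by
    refine hasDerivAt_of_weak_deriv (by fun_prop) hw fun φ hφ hφc => ?_
    have hdφ : ContDiff ℝ ∞ (deriv φ) := (contDiff_infty_iff_deriv.1 hφ).2
    have h1 := h.momentum_eq φ hφ hφc t ht
    have h2 : HasDerivAt (fun s => ∫ x, ρ s x * u s x * φ x)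
        (∫ x, (Rt * U t + R t * Ut) x * φ x) t := by
      refine (hasDerivAt_integral_mul (hRt.mul hUt) hφ.continuous hφc).congr_of_eventuallyEq ?_
      filter_upwards [Icc_mem_nhds ht.1 ht.2] with s hs
      refine integral_congr_ae ?_
      filter_upwards [hR s hs, hU s hs] with x hx hx'
      simp [hx, hx']
    have h3 : ∫ x, (ρ t x * u t x ^ 2 + pressure A γ (ρ t x)) * deriv φ x =
        ∫ x, (R t x * U t x ^ 2 + pressure A γ (R t x)) * deriv φ x := by
      refine integral_congr_ae ?_
      filter_upwards [hR t htI, hU t htI] with x hx hx'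
      rw [hx, hx']
    have h4 : ∫ x, u t x * deriv (deriv φ) x = ∫ x, U t x * deriv (deriv φ) x := by
      refine integral_congr_ae ?_
      filter_upwards [hU t htI] with x hx
      rw [hx]
    have h5 := h2.unique h1
    rw [h3, h4, integral_mul_deriv_eq_neg hflux (by fun_prop) hφ hφc,
      integral_mul_deriv_eq_neg hUx (by fun_prop) hdφ hφc.deriv] at h5
    have hinteg : ∀ {f : ℝ → ℝ}, Continuous f → Integrable (fun x => f x * φ x) := fun hf =>
      (hf.mul hφ.continuous).integrable_of_hasCompactSupport hφc.mul_left
    have h6 : ∫ x, (w x - (Rt x * U t x + R t x * Ut x)) * φ x =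
        (∫ x, w x * φ x) - ∫ x, (Rt * U t + R t * Ut) x * φ x := by
      rw [← integral_sub (hinteg hw) (hinteg (map_continuous _))]
      congr 1; ext x
      simp only [BoundedContinuousFunction.add_apply, BoundedContinuousFunction.mul_apply]
      ring
    rw [h6] at h5
    simp_rw [mul_assoc]
    rw [integral_const_mul]
    linarith
  have := (hweak x).const_mul ν⁻¹
  convert! this using 1
  · ext y; field_simp
  · field_simp; rfl

/-- A solution in `C¹([0,T]; H^m)` has a representative that solves the equations pointwise. -/
theorem exists_strong (h : IsSolution μ lam A γ m T ρ₀ u₀ ρ u) (hm : 3 / 2 < m) (hA : 0 < A)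
    (hγ : 1 < γ) (hν : 0 < μ + (μ + lam)) (hT : 0 < T) (hρ₀ : Continuous ρ₀) (hu₀ : Continuous u₀)
    (hρ₀_nonneg : ∀ x, 0 ≤ ρ₀ x) :
    ∃ (M : ℝ) (ρ' u' ux' : ℝ → ℝ → ℝ), IsStrongSolution (μ + (μ + lam)) A γ T M ρ' u' ux' ∧
      ρ' 0 = ρ₀ ∧ u' 0 = u₀ := by
  obtain ⟨R, Rx, hRc, hRxc, hR⟩ := h.density_mem.exists_curve hm
  obtain ⟨U, Ux, hUc, hUxc, hU⟩ := h.velocity_mem.exists_curve hm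
  obtain ⟨Rt, B₁, hRt, hB₁⟩ := exists_bound_of_contDiffOn hRc hT
  obtain ⟨_, B₂, -, hB₂⟩ := exists_bound_of_contDiffOn hRxc hT
  obtain ⟨Ut, B₃, hUt, hB₃⟩ := exists_bound_of_contDiffOn hUc hT
  obtain ⟨_, B₄, -, hB₄⟩ := exists_bound_of_contDiffOn hUxc hT
  have h0T : (0 : ℝ) ∈ Icc 0 T := ⟨le_rfl, hT.le⟩
  have hRae := fun t ht => (hR t ht).1
  have hUae := fun t ht => (hU t ht).1
  have hR0 : ⇑(R 0) = ρ₀ := (Continuous.ae_eq_iff_eq volume (map_continuous _) hρ₀).1 (by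
    filter_upwards [hRae 0 h0T, h.density_init] with x h1 h2
    rw [← h1, h2])
  have hU0 : ⇑(U 0) = u₀ := (Continuous.ae_eq_iff_eq volume (map_continuous _) hu₀).1 (by
    filter_upwards [hUae 0 h0T, h.velocity_init] with x h1 h2
    rw [← h1, h2])
  -- The constant stays free: a first use yields `ρ ≥ 0`, needed to bound `ρ^(γ-1)` and thus `u_xx`
  -- by `D`; the final constant also absorbs `D`.
  have htrans : ∀ M, B₃ ≤ M → B₄ ≤ M →
      IsTransported T M (fun t x => R t x) (fun t x => U t x) (fun t x => Ux t x) := by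
    intro M h3 h4
    refine ⟨continuousOn_uncurry_curve hRc.continuousOn, continuousOn_uncurry_curve hUc.continuousOn,
      fun t ht x => ((hB₃ t ht).1 x).trans h3, fun t ht x => ((hB₄ t ht).1 x).trans h4,
      fun t ht => (hU t ht).2.1, fun Z t ht hZ => ?_⟩
    have htI : t ∈ Icc 0 T := ⟨ht.1.le, ht.2.le⟩
    have h1 := hasDerivAt_eval_curve (hRt t ht) hZ ((hR t htI).2.1 (Z t))
    rw [h.continuity_pointwise hRae hUae ht (hR t htI).2.1 (hU t htI).2.1 (hRt t ht)] at h1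
    convert! h1 using 1
    ring
  have hRnonneg : ∀ t ∈ Icc 0 T, ∀ x, 0 ≤ R t x := fun t ht x =>
    (htrans _ (le_max_left B₃ B₄) (le_max_right B₃ B₄)).density_nonneg hT
      (by rw [hR0]; exact hρ₀_nonneg) ht x
  have hB₁0 : 0 ≤ B₁ := (abs_nonneg _).trans ((hB₁ 0 h0T).1 0)
  have hB₃0 : 0 ≤ B₃ := (abs_nonneg _).trans ((hB₃ 0 h0T).1 0)
  have hγ0 : 0 < γ := by linarith
  set ν := μ + (μ + lam) with hνdef
  set D := (B₁ * (B₃ + B₃ * B₄) + A * γ * B₁ ^ (γ - 1) * B₂) / ν with hD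
  have hmom : ∀ t (ht : t ∈ Ioo 0 T) (x : ℝ), HasDerivAt (Ux t) ((R t x * (Ut t x + U t x * Ux t x)
      + A * γ * R t x ^ (γ - 1) * Rx t x) / ν) x := fun t ht x =>
    have htI : t ∈ Icc 0 T := ⟨ht.1.le, ht.2.le⟩
    h.momentum_pointwise hγ hν hRae hUae ht (hR t htI).2.1 (hU t htI).2.1 (hRt t ht) (hUt t ht) x
  have hmom_le : ∀ t ∈ Ioo 0 T, ∀ x, |(R t x * (Ut t x + U t x * Ux t x)
      + A * γ * R t x ^ (γ - 1) * Rx t x) / ν| ≤ D := by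
    intro t ht x
    have htI : t ∈ Icc 0 T := ⟨ht.1.le, ht.2.le⟩
    rw [abs_div, abs_of_pos hν]
    refine div_le_div_of_nonneg_right ((abs_add_le _ _).trans (add_le_add ?_ ?_)) hν.le
    · rw [abs_mul]
      refine mul_le_mul ((hB₁ t htI).1 x) ((abs_add_le _ _).trans (add_le_add ((hB₃ t htI).2 x) ?_))
        (abs_nonneg _) hB₁0
      rw [abs_mul]
      exact mul_le_mul ((hB₃ t htI).1 x) ((hB₄ t htI).1 x) (abs_nonneg _) hB₃0
    · have hRn := hRnonneg t htI x
      rw [abs_mul, abs_of_nonneg (by positivity : 0 ≤ A * γ * R t x ^ (γ - 1))]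
      refine mul_le_mul (mul_le_mul_of_nonneg_left ?_ (by positivity)) ((hB₂ t htI).1 x)
        (abs_nonneg _) (by positivity)
      exact Real.rpow_le_rpow hRn ((le_abs_self _).trans ((hB₁ t htI).1 x)) (by linarith)
  refine ⟨max (max B₃ B₄) D, fun t x => R t x, fun t x => U t x, fun t x => Ux t x,
    ⟨htrans _ ((le_max_left _ _).trans (le_max_left _ _)) ((le_max_right _ _).trans (le_max_left _ _)),
      fun t ht => (hU t ht).2.2, fun t ht x y => ?_, fun t ht x => ?_⟩, hR0, hU0⟩
  · have h1 := convex_univ.norm_image_sub_le_of_norm_hasDerivWithin_le (C := max (max B₃ B₄) D)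
      (fun z _ => (hmom t ht z).hasDerivWithinAt)
      (fun z _ => (hmom_le t ht z).trans (le_max_right _ _)) (mem_univ y) (mem_univ x)
    simpa [Real.norm_eq_abs] using h1
  · have htI : t ∈ Icc 0 T := ⟨ht.1.le, ht.2.le⟩
    refine ⟨Rx t x, Ut t x, _, (hR t htI).2.1 x, ?_, hmom t ht x, ?_⟩
    · simpa using hasDerivAt_eval_curve (hUt t ht) (hasDerivAt_const t x) ((hU t htI).2.1 x)
    · rw [mul_div_cancel₀ _ hν.ne']

end IsSolution

end IsentropicNS

theorem theorem1p1 (μ lam A γ m : ℝ) (hμ : 0 < μ) (hlam : 0 < 2 * μ + lam) (hA : 0 < A)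
    (hγ : 1 < γ) (hm : 2 < m) (ρ₀ u₀ : ℝ → ℝ) (hρ₀ : Continuous ρ₀) (hu₀ : Continuous u₀)
    (hsupp : tsupport ρ₀ = Set.Icc 0 1) (hpos : ∀ x ∈ Set.Ioo (0 : ℝ) 1, 0 < ρ₀ x)
    (hcond : IsentropicNS.LeftCondition ρ₀ u₀ ∨ IsentropicNS.RightCondition ρ₀ u₀)
    (T : ℝ) (hT : 0 < T) :
    ¬ ∃ ρ u : ℝ → ℝ → ℝ, IsentropicNS.IsSolution μ lam A γ m T ρ₀ u₀ ρ u := by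
  rintro ⟨ρ, u, h⟩
  have hν : 0 < μ + (μ + lam) := by linarith
  have hvac : ∀ x, x ∉ Set.Icc (0 : ℝ) 1 → ρ₀ x = 0 := fun x hx =>
    image_eq_zero_of_notMem_tsupport (by rwa [hsupp])
  have hnonneg : ∀ x, 0 ≤ ρ₀ x := by
    intro x
    by_cases hx : x ∈ Set.Icc (0 : ℝ) 1
    · have hcl : closure (Set.Ioo (0 : ℝ) 1) ⊆ {x | 0 ≤ ρ₀ x} :=
        closure_minimal (fun y hy => (hpos y hy).le) (isClosed_le continuous_const hρ₀)
      rw [closure_Ioo zero_ne_one] at hcl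
      exact hcl hx
    · exact (hvac x hx).ge
  obtain ⟨M, ρ', u', ux', hs, rfl, rfl⟩ :=
    h.exists_strong (by linarith) hA hγ hν hT hρ₀ hu₀ hnonneg
  rcases hcond with hc | hc
  · exact hs.not_leftCondition hν hA hγ hT (fun x hx => hvac x fun hx' => hx.not_ge hx'.1) hpos hc
  · exact hs.not_rightCondition hν hA hγ hT (fun x hx => hvac x fun hx' => hx.not_ge hx'.2) hpos hc
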